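/- All graphs are finite, simple and undirected. For a positive integer $K$ and a graph $H$, a *$K$-fat minor model* of $H$ in a graph $G$ is a family of connected (non-empty) subgraphs $(B_v)_{v\in V(H)}$, $(P_e)_{e\in E(H)}$ of $G$ such that $V(B_v)\cap V(P_e)\ne\emptyset$ whenever $v$ is an end-vertex of $e$, and any two distinct members of the family that are not such an incident pair are at distance at least $K$ in $G$ (vertices in different components are at infinite distance). $G$ *contains $H$ as a $K$-fat minor* if it has such a model, and a class of graphs is *$H$-asymptotic minor-free* if for some integer $K\ge 1$ no graph of the class contains $H$ as a $K$-fat minor. Let $U_4$ be the graph obtained from a path on $4$ vertices by adding a vertex adjacent to all of them. A *hole* is an induced cycle of length at least $4$; a graph is *monoholed* if all its holes have the same length (graphs without holes are included). A *$3$-path configuration* of $G$ is an induced subgraph of $G$ that is a theta, a pyramid or a prism, where: a *theta* consists of three induced paths of length at least $2$ between the same two vertices $a,b$, pairwise disjoint except at $a,b$; a *pyramid* consists of three induced paths from a vertex $a$ to the vertices $b_1,b_2,b_3$ of a triangle, pairwise disjoint except at $a$, at least two of them of length at least $2$; a *prism* consists of three pairwise disjoint induced paths of length at least $1$ joining $a_i$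 to $b_i$ ($i=1,2,3$), where $a_1a_2a_3$ and $b_1b_2b_3$ are triangles; in each case there are no edges between different paths other than the edges of the paths and of the triangles. It is *balanced* if its three paths have the same length, which is then its *length*. An *isometric path* is a shortest path between its end-vertices; it is *$r$-rooted* if $r$ is one of its end-vertices. The *strong isometric path complexity* of a connected graph $G$ is the least integer $k$ such that, for every vertex $r$ of $G$, the vertices of every isometric path of $G$ can be covered by $k$ $r$-rooted isometric paths. **Theorem.** (1) No monoholed graph contains $U_4$ as a $10$-fat minor. (2) If all $3$-path configurations of a graph $G$ are balanced and have the same length, then $G$ does not contain $U_4$ as a $10$-fat minor. (3) Consequently, the class of monoholed graphs is $U_4$-asymptotic minor-free. (4) There is a constant $k$ such that every connected monoholed graph has strong isometric path complexity at most $k$. -/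

import Mathlib

universe u v

namespace FatMinors

/-- The fan `U_t`: a path on the `t` vertices `some 0, …, some (t - 1)` together with a universal
vertex `none`. -/
def fan (t : ℕ) : SimpleGraph (Option (Fin t)) where
  Adj
    | none, none => False
    | none, some _ => True
    | some _, none => True
    | some i, some j => (SimpleGraph.pathGraph t).Adj i j
  symm := ⟨by
    rintro (_ | i) (_ | j) h
    · exact h
    · trivial
    · trivial
    · exact SimpleGraph.Adj.symm h⟩
  loopless := ⟨by
    rintro (_ | i) h
    · exact h
    · exact SimpleGraph.irrefl _ h⟩

variable {V : Type u} {W : Type v}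

/-- The distance in `G` between the vertex sets `X` and `Y` is at least `K`.  The extended distance
is used, so that vertices in different components of `G` are infinitely far apart. -/
def FarApart (G : SimpleGraph V) (K : ℕ) (X Y : Set V) : Prop :=
  ∀ x ∈ X, ∀ y ∈ Y, (K : ℕ∞) ≤ G.edist x y

/-- A `K`-fat minor model of `H` in `G`: connected (in particular non-empty) subgraphs of `G`, one
for each vertex of `H` and one for each edge of `H`, such that incident pairs intersect and all
other pairs are at distance at least `K`. -/
structure FatMinorModel (K : ℕ) (H : SimpleGraph W) (G : SimpleGraph V) where
  branchSet : W → G.Subgraph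
  branchPath : H.edgeSet → G.Subgraph
  branchSet_connected : ∀ w, (branchSet w).Connected
  branchPath_connected : ∀ e, (branchPath e).Connected
  incident : ∀ (w : W) (e : H.edgeSet), w ∈ (e : Sym2 W) →
    ((branchSet w).verts ∩ (branchPath e).verts).Nonempty
  far_set_set : ∀ w w' : W, w ≠ w' → FarApart G K (branchSet w).verts (branchSet w').verts
  far_path_path : ∀ e e' : H.edgeSet, e ≠ e' →
    FarApart G K (branchPath e).verts (branchPath e').verts
  far_set_path : ∀ (w : W) (e : H.edgeSet), w ∉ (e : Sym2 W) →
    FarApart G K (branchSet w).verts (branchPath e).verts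

/-- `H` is a `K`-fat minor of `G`. -/
def HasFatMinor (K : ℕ) (H : SimpleGraph W) (G : SimpleGraph V) : Prop :=
  Nonempty (FatMinorModel K H G)

/-- The class of all finite graphs with property `C` contains `H` as an asymptotic minor. -/
def HasAsymptoticMinor (C : ∀ V : Type u, SimpleGraph V → Prop) (H : SimpleGraph W) : Prop :=
  ∀ K : ℕ, 1 ≤ K → ∃ (V : Type u) (_ : Finite V) (G : SimpleGraph V), C V G ∧ HasFatMinor K H G

/-- `G` has a hole, i.e. an induced cycle of length at least `4`, of length `n`. -/
def HasHole (G : SimpleGraph V) (n : ℕ) : Prop :=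
  4 ≤ n ∧ Nonempty (SimpleGraph.cycleGraph n ↪g G)

/-- All holes of `G` have the same length. -/
def Monoholed (G : SimpleGraph V) : Prop :=
  ∃ l : ℕ, ∀ n : ℕ, HasHole G n → n = l

/-- `p` is an induced path: its vertices are distinct and all edges of `G` between them are edges
of `p`. -/
def IsInducedPath {G : SimpleGraph V} {a b : V} (p : G.Walk a b) : Prop :=
  p.IsPath ∧ p.IsChordless

/-- The three paths `P 0`, `P 1`, `P 2` from `a` to `b` induce a theta in `G`. -/
structure IsTheta (G : SimpleGraph V) (a b : V) (P : Fin 3 → G.Walk a b) : Prop where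
  induced : ∀ i, IsInducedPath (P i)
  two_le_length : ∀ i, 2 ≤ (P i).length
  disjoint : ∀ i j, i ≠ j → ∀ x ∈ (P i).support, x ∈ (P j).support → x = a ∨ x = b
  no_edges : ∀ i j, i ≠ j → ∀ x ∈ (P i).support, ∀ y ∈ (P j).support, G.Adj x y →
    s(x, y) ∈ (P i).edges ∨ s(x, y) ∈ (P j).edges

/-- The three paths `P i` from `a` to `b i` induce a pyramid in `G`. -/
structure IsPyramid (G : SimpleGraph V) (a : V) (b : Fin 3 → V)
    (P : ∀ i : Fin 3, G.Walk a (b i)) : Prop where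
  induced : ∀ i, IsInducedPath (P i)
  two_le_length : ∃ k, ∀ i, i ≠ k → 2 ≤ (P i).length
  disjoint : ∀ i j, i ≠ j → ∀ x ∈ (P i).support, x ∈ (P j).support → x = a
  triangle : ∀ i j, i ≠ j → G.Adj (b i) (b j)
  no_edges : ∀ i j, i ≠ j → ∀ x ∈ (P i).support, ∀ y ∈ (P j).support, G.Adj x y →
    s(x, y) ∈ (P i).edges ∨ s(x, y) ∈ (P j).edges ∨ (x = b i ∧ y = b j)

/-- The three paths `P i` from `a i` to `b i` induce a prism in `G`. -/
structure IsPrism (G : SimpleGraph V) (a b : Fin 3 → V)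
    (P : ∀ i : Fin 3, G.Walk (a i) (b i)) : Prop where
  induced : ∀ i, IsInducedPath (P i)
  one_le_length : ∀ i, 1 ≤ (P i).length
  disjoint : ∀ i j, i ≠ j → ∀ x ∈ (P i).support, x ∉ (P j).support
  triangle_left : ∀ i j, i ≠ j → G.Adj (a i) (a j)
  triangle_right : ∀ i j, i ≠ j → G.Adj (b i) (b j)
  no_edges : ∀ i j, i ≠ j → ∀ x ∈ (P i).support, ∀ y ∈ (P j).support, G.Adj x y →
    (x = a i ∧ y = a j) ∨ (x = b i ∧ y = b j)

/-- `G` contains, as an induced subgraph, a `3`-path configuration (a theta, a pyramid or a prism)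
whose three paths have lengths `l 0`, `l 1`, `l 2`. -/
def HasThreePathConfiguration (G : SimpleGraph V) (l : Fin 3 → ℕ) : Prop :=
  (∃ (a b : V) (P : Fin 3 → G.Walk a b), IsTheta G a b P ∧ ∀ i, (P i).length = l i) ∨
  (∃ (a : V) (b : Fin 3 → V) (P : ∀ i : Fin 3, G.Walk a (b i)),
    IsPyramid G a b P ∧ ∀ i, (P i).length = l i) ∨
  (∃ (a b : Fin 3 → V) (P : ∀ i : Fin 3, G.Walk (a i) (b i)),
    IsPrism G a b P ∧ ∀ i, (P i).length = l i)

/-- All `3`-path configurations contained in `G` are balanced (their three paths have equal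
lengths) and have the same length. -/
def UniformThreePathConfigurations (G : SimpleGraph V) : Prop :=
  ∃ L : ℕ, ∀ l : Fin 3 → ℕ, HasThreePathConfiguration G l → ∀ i, l i = L

/-- `p` is an isometric path, i.e. a shortest path between its end-vertices (a walk of this length
has no repeated vertices). -/
def IsIsometricPath {G : SimpleGraph V} {a b : V} (p : G.Walk a b) : Prop :=
  p.length = G.dist a b

/-- The vertex set `S` can be covered by `k` isometric paths of `G` that start in `r`. -/
def CoveredByRooted (G : SimpleGraph V) (r : V) (k : ℕ) (S : Set V) : Prop :=
  ∃ (t : Fin k → V) (q : ∀ i : Fin k, G.Walk r (t i)),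
    (∀ i, IsIsometricPath (q i)) ∧ ∀ x ∈ S, ∃ i, x ∈ (q i).support

/-- The strong isometric path complexity of `G`: the least `k` such that for every vertex `r`, the
vertices of every isometric path of `G` can be covered by `k` isometric paths rooted at `r`
(and `⊤` if there is no such `k`, which does not happen in a finite connected graph). -/
noncomputable def strongIsometricPathComplexity (G : SimpleGraph V) : ℕ∞ :=
  ⨅ (k : ℕ) (_ : ∀ (r a b : V) (p : G.Walk a b), IsIsometricPath p →
    CoveredByRooted G r k {x | x ∈ p.support}), (k : ℕ∞)

end FatMinors

/-! Two paths of a theta, a pyramid or a prism form a hole of length `l i + l j + c` with `c = 0`,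
`1` or `2`. In a monoholed graph the three lengths are therefore equal, and over all configurations
they take at most two consecutive values `L - 1` and `L` (`Monoholed.almost_uniform`). Under the
hypothesis of (2) they are constant. So (1) and (2) both follow from
`not_hasFatMinor_of_almost_uniform`, and (3) is (1) with fatness 10.

For that lemma, let X and Y be the branch sets of the two inner path vertices of the fan, and Z that
of the hub. A fat model gives one rail between X and Y, two between X and Z, and two between Y and
Z, where the outer path vertices are absorbed into rails. Inside a connected set any three
prescribed vertices are the leaves of a tripod (`exists_tripod`). Tripods in X and Z joined by the
two XZ rails and by a detour through Y form a 3-path configuration; so do tripods in Y and Z joined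
by the two YZ rails and by a detour through X. The outer YZ rail is a whole connection in the second
configuration, but only a part of the detour in the first, which also contains the XY rail. If the
tripods in Z are chosen so that their arms to this rail have nearly the same length, the two path
lengths differ by about the length of the XY rail, which is too much
(`IsRailSystem.not_almost_uniform`).

For (4), let `f` be the distance to `r` along an isometric path. Call two of its vertices comparable
if `f` changes between them at full speed, so that one rooted isometric path contains both. A greedy
choice either covers the path by few rooted isometric paths or gives a long sequence of vertices in
which consecutive ones are incomparable (`IsIsometricPath.covered_or_exists_antichain`). From four
widely spaced members of a long sequence, shortest walks to `r` leave the neighbourhood of the path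
for good at distant places. These walks form the hub and the spokes of a fat fan
(`IsIsometricPath.hasFatMinor`), contradicting (1). -/

namespace FatMinors

open SimpleGraph

variable {V : Type u} {G : SimpleGraph V}

/-! ### Touching vertices and induced paths. -/

/-- Two vertices touch if they are equal or adjacent. -/
def Touch (G : SimpleGraph V) (x y : V) : Prop := x = y ∨ G.Adj x y

theorem Touch.refl (x : V) : Touch G x x := Or.inl rfl

theorem Touch.symm {x y : V} (h : Touch G x y) : Touch G y x :=
  h.imp Eq.symm SimpleGraph.Adj.symm

theorem Touch.exists_walk {x y : V} (h : Touch G x y) :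
    ∃ p : G.Walk x y, p.length ≤ 1 ∧ ∀ z ∈ p.support, z = x ∨ z = y := by
  rcases h with rfl | h
  · exact ⟨.nil, by simp, by simp⟩
  · exact ⟨h.toWalk, by simp, by simp⟩

theorem exists_getVert_of_mem {a b x : V} {p : G.Walk a b} (h : x ∈ p.support) :
    ∃ i ≤ p.length, p.getVert i = x := by
  obtain ⟨i, h1, h2⟩ := Walk.mem_support_iff_exists_getVert.1 h
  exact ⟨i, h2, h1⟩

theorem mem_support_take {a b x : V} {p : G.Walk a b} {n : ℕ} (h : x ∈ (p.take n).support) :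
    ∃ i ≤ n, i ≤ p.length ∧ p.getVert i = x := by
  obtain ⟨i, h1, h2⟩ := exists_getVert_of_mem h
  rw [Walk.take_length] at h1
  rw [Walk.take_getVert] at h2
  exact ⟨n ⊓ i, by omega, by omega, h2⟩

theorem mem_support_drop {a b x : V} {p : G.Walk a b} {n : ℕ} (hn : n ≤ p.length)
    (h : x ∈ (p.drop n).support) :
    ∃ i, n ≤ i ∧ i ≤ p.length ∧ p.getVert i = x := by
  obtain ⟨i, h1, h2⟩ := exists_getVert_of_mem h
  rw [Walk.drop_length] at h1
  rw [Walk.drop_getVert] at h2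
  exact ⟨n + i, by omega, by omega, h2⟩

theorem mem_of_mem_take {a b x : V} {p : G.Walk a b} {n : ℕ} (h : x ∈ (p.take n).support) :
    x ∈ p.support := by
  obtain ⟨i, -, -, rfl⟩ := mem_support_take h
  exact p.getVert_mem_support i

theorem mem_of_mem_drop {a b x : V} {p : G.Walk a b} {n : ℕ} (h : x ∈ (p.drop n).support) :
    x ∈ p.support := by
  obtain ⟨i, h1, h2⟩ := exists_getVert_of_mem h
  rw [Walk.drop_getVert] at h2
  exact h2 ▸ p.getVert_mem_support _

namespace IsInducedPath

variable {a b c : V} {p : G.Walk a b}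

theorem getVert_inj (hp : IsInducedPath p) {i j : ℕ} (hi : i ≤ p.length) (hj : j ≤ p.length)
    (h : p.getVert i = p.getVert j) : i = j :=
  hp.1.getVert_injOn hi hj h

theorem touch_getVert (hp : IsInducedPath p) {i j : ℕ} (hij : i < j) (hj : j ≤ p.length)
    (h : Touch G (p.getVert i) (p.getVert j)) : j = i + 1 := by
  rcases h with h | h
  · exact absurd (hp.getVert_inj (by omega) hj h) (by omega)
  · have := hp.2.mem_edges (p.getVert_mem_support i) (p.getVert_mem_support j) h
    rw [Walk.mk_mem_edges_iff_exists] at this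
    obtain ⟨k, hk, h⟩ := this
    rw [Sym2.eq_iff] at h
    rcases h with h | h <;>
    · have h1 := hp.getVert_inj (by omega) (by omega) h.1
      have h2 := hp.getVert_inj (by omega) (by omega) h.2
      omega

/-- Since touching includes equality, the one hypothesis gives both injectivity and the absence of
chords: equal vertices would have consecutive indices and thus be adjacent. -/
theorem of_touch
    (h : ∀ i j, i < j → j ≤ p.length → Touch G (p.getVert i) (p.getVert j) → j = i + 1) :
    IsInducedPath p := by
  refine ⟨?_, ?_⟩
  · rw [← Walk.IsPath.getVert_injOn_iff]
    have key : ∀ i j, i < j → j ≤ p.length → p.getVert i ≠ p.getVert j := by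
      intro i j hij hj he
      have := h i j hij hj (Or.inl he)
      subst this
      exact (p.adj_getVert_succ (by omega)).ne he
    intro i hi j hj he
    rcases lt_trichotomy i j with hij | hij | hij
    · exact absurd he (key i j hij hj)
    · exact hij
    · exact absurd he.symm (key j i hij hi)
  · rw [Walk.isChordless_iff_forall_mem_edges]
    intro x y hx hy hxy
    obtain ⟨i, hi, rfl⟩ := exists_getVert_of_mem hx
    obtain ⟨j, hj, rfl⟩ := exists_getVert_of_mem hy
    rw [Walk.mk_mem_edges_iff_exists]
    rcases lt_trichotomy i j with hij | hij | hij
    · have := h i j hij hj (Or.inr hxy)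
      subst this
      exact ⟨i, by omega, rfl⟩
    · subst hij
      exact absurd rfl hxy.ne
    · have := h j i hij hi (Or.inr hxy.symm)
      subst this
      exact ⟨j, by omega, Sym2.eq_swap⟩

theorem nil (x : V) : IsInducedPath (Walk.nil : G.Walk x x) :=
  of_touch (by intro i j h1 h2; simp at h2; omega)

theorem reverse (hp : IsInducedPath p) : IsInducedPath p.reverse := by
  refine of_touch fun i j hij hj h => ?_
  rw [Walk.length_reverse] at hj
  rw [Walk.getVert_reverse, Walk.getVert_reverse] at h
  have := hp.touch_getVert (by omega) (by omega) h.symm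
  omega

theorem take (hp : IsInducedPath p) (n : ℕ) : IsInducedPath (p.take n) := by
  refine of_touch fun i j hij hj h => ?_
  rw [Walk.take_length] at hj
  rw [Walk.take_getVert, Walk.take_getVert, min_eq_right (by omega), min_eq_right (by omega)] at h
  exact hp.touch_getVert hij (by omega) h

theorem drop (hp : IsInducedPath p) (n : ℕ) : IsInducedPath (p.drop n) := by
  refine of_touch fun i j hij hj h => ?_
  rw [Walk.drop_length] at hj
  rw [Walk.drop_getVert, Walk.drop_getVert] at h
  have := hp.touch_getVert (by omega) (by omega) h
  omega

theorem copy (hp : IsInducedPath p) {a' b' : V} (ha : a = a') (hb : b = b') :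
    IsInducedPath (p.copy ha hb) := by
  subst ha hb
  exact hp

theorem append (hp : IsInducedPath p) {q : G.Walk b c} (hq : IsInducedPath q)
    (h : ∀ x ∈ p.support, ∀ y ∈ q.support, Touch G x y → x = b ∨ y = b) :
    IsInducedPath (p.append q) := by
  refine of_touch fun i j hij hj ht => ?_
  rw [Walk.length_append] at hj
  rw [Walk.getVert_append', Walk.getVert_append'] at ht
  by_cases hjp : j ≤ p.length
  · rw [if_pos (by omega), if_pos hjp] at ht
    exact hp.touch_getVert hij hjp ht
  rw [if_neg hjp] at ht
  by_cases hip : i ≤ p.length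
  · rw [if_pos hip] at ht
    rcases h _ (p.getVert_mem_support _) _ (q.getVert_mem_support _) ht with h1 | h1
    · have := hp.getVert_inj hip le_rfl (h1.trans p.getVert_length.symm)
      subst this
      rw [Walk.getVert_length] at ht
      have := hq.touch_getVert (i := 0) (j := j - p.length) (by omega) (by omega) (by simpa using ht)
      omega
    · have := hq.getVert_inj (i := j - p.length) (j := 0) (by omega) (by omega)
        (h1.trans q.getVert_zero.symm)
      omega
  · rw [if_neg hip] at ht
    have := hq.touch_getVert (by omega) (by omega) ht
    omega

theorem cons (hp : IsInducedPath p) (h : G.Adj c a)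
    (ht : ∀ y ∈ p.support, Touch G c y → y = a) : IsInducedPath (Walk.cons h p) := by
  have h1 : IsInducedPath h.toWalk := by
    refine of_touch fun i j hij hj _ => ?_
    simp at hj
    omega
  have := h1.append hp (by
    intro x hx y hy hxy
    simp at hx
    rcases hx with rfl | rfl
    · exact Or.inr (ht y hy hxy)
    · exact Or.inl rfl)
  simpa using this

theorem two_le_length_of_not_touch (h : ¬ Touch G a b) : 2 ≤ p.length := by
  match p with
  | .nil => exact absurd (Touch.refl _) h
  | .cons e .nil => exact absurd (Or.inr e) h
  | .cons _ (.cons _ _) => simp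

end IsInducedPath

/-! ### Shortest walks inside a set and connected vertex sets. -/

/-- A walk of minimal length among the walks inside `H` from `S` to `T` is an induced path that
meets `S` and `T` only in its ends. -/
theorem exists_shortest_walk {H S T : Set V}
    (h : ∃ a ∈ S, ∃ b ∈ T, ∃ p : G.Walk a b, ∀ z ∈ p.support, z ∈ H) :
    ∃ a ∈ S, ∃ b ∈ T, ∃ p : G.Walk a b, (∀ z ∈ p.support, z ∈ H) ∧ IsInducedPath p ∧
      (∀ x ∈ p.support, x ∈ S → x = a) ∧ (∀ x ∈ p.support, x ∈ T → x = b) ∧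
      ∀ a' ∈ S, ∀ b' ∈ T, ∀ q : G.Walk a' b', (∀ z ∈ q.support, z ∈ H) → p.length ≤ q.length := by
  classical
  have hex : ∃ n, ∃ a ∈ S, ∃ b ∈ T, ∃ p : G.Walk a b, (∀ z ∈ p.support, z ∈ H) ∧ p.length = n := by
    obtain ⟨a, ha, b, hb, p, hp⟩ := h
    exact ⟨_, a, ha, b, hb, p, hp, rfl⟩
  obtain ⟨a, ha, b, hb, p, hp, hlen⟩ := Nat.find_spec hex
  have hmin : ∀ a' ∈ S, ∀ b' ∈ T, ∀ q : G.Walk a' b', (∀ z ∈ q.support, z ∈ H) →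
      p.length ≤ q.length := by
    intro a' ha' b' hb' q hq
    rw [hlen]
    exact Nat.find_min' hex ⟨a', ha', b', hb', q, hq, rfl⟩
  refine ⟨a, ha, b, hb, p, hp, ?_, ?_, ?_, hmin⟩
  · refine IsInducedPath.of_touch fun i j hij hj ht => ?_
    obtain ⟨e, he1, he2⟩ := ht.exists_walk
    -- If the vertices with indices `i` and `j` touch, the step `e` of length at most one is a
    -- shortcut, so minimality forces `j ≤ i + 1`.
    have := hmin a ha b hb ((p.take i).append (e.append (p.drop j))) (by
      intro z hz
      rw [Walk.mem_support_append_iff, Walk.mem_support_append_iff] at hz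
      rcases hz with hz | hz | hz
      · exact hp z (mem_of_mem_take hz)
      · rcases he2 z hz with rfl | rfl <;> exact hp _ (p.getVert_mem_support _)
      · exact hp z (mem_of_mem_drop hz))
    simp only [Walk.length_append, Walk.take_length, Walk.drop_length] at this
    omega
  · intro x hx hxS
    obtain ⟨i, hi, rfl⟩ := exists_getVert_of_mem hx
    have := hmin _ hxS b hb (p.drop i) (fun z hz => hp z (mem_of_mem_drop hz))
    rw [Walk.drop_length] at this
    obtain rfl | h0 : i = 0 ∨ p.length = 0 := by omega
    · simp
    · obtain rfl : i = 0 := by omega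
      simp
  · intro x hx hxT
    obtain ⟨i, hi, rfl⟩ := exists_getVert_of_mem hx
    have := hmin a ha _ hxT (p.take i) (fun z hz => hp z (mem_of_mem_take hz))
    rw [Walk.take_length] at this
    obtain rfl : i = p.length := by omega
    simp

/-- Any two vertices of `H` are joined by a walk inside `H`. -/
def JoinedIn (G : SimpleGraph V) (H : Set V) : Prop :=
  ∀ x ∈ H, ∀ y ∈ H, ∃ p : G.Walk x y, ∀ z ∈ p.support, z ∈ H

theorem JoinedIn.of_base {H : Set V} (b : V)
    (h : ∀ x ∈ H, ∃ p : G.Walk x b, ∀ z ∈ p.support, z ∈ H) : JoinedIn G H := by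
  intro x hx y hy
  obtain ⟨p, hp⟩ := h x hx
  obtain ⟨q, hq⟩ := h y hy
  refine ⟨p.append q.reverse, fun z hz => ?_⟩
  rw [Walk.mem_support_append_iff, Walk.support_reverse, List.mem_reverse] at hz
  exact hz.elim (hp z) (hq z)

theorem JoinedIn.union {H K : Set V} (hH : JoinedIn G H) (hK : JoinedIn G K)
    (h : (H ∩ K).Nonempty) : JoinedIn G (H ∪ K) := by
  obtain ⟨b, hb1, hb2⟩ := h
  refine JoinedIn.of_base b ?_
  rintro x (hx | hx)
  · obtain ⟨p, hp⟩ := hH x hx b hb1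
    exact ⟨p, fun z hz => Or.inl (hp z hz)⟩
  · obtain ⟨p, hp⟩ := hK x hx b hb2
    exact ⟨p, fun z hz => Or.inr (hp z hz)⟩

theorem JoinedIn.support {a b : V} (p : G.Walk a b) : JoinedIn G {x | x ∈ p.support} := by
  classical
  refine JoinedIn.of_base b fun x hx => ⟨p.dropUntil x hx, fun z hz => ?_⟩
  exact p.support_dropUntil_subset_support hx hz

theorem JoinedIn.of_connected {H : G.Subgraph} (h : H.Connected) : JoinedIn G H.verts := by
  rw [Subgraph.connected_iff_forall_exists_walk_subgraph] at h
  intro x hx y hy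
  obtain ⟨p, hp⟩ := h.2 hx hy
  exact ⟨p, fun z hz => hp.1 (p.mem_verts_toSubgraph.2 hz)⟩

theorem JoinedIn.connected {H : Set V} (h : JoinedIn G H) (hne : H.Nonempty) :
    ((⊤ : G.Subgraph).induce H).Connected := by
  rw [Subgraph.connected_iff_forall_exists_walk_subgraph]
  refine ⟨hne, fun {x y} hx hy => ?_⟩
  obtain ⟨p, hp⟩ := h x hx y hy
  refine ⟨p, ?_⟩
  have h1 : p.toSubgraph.verts ⊆ H := fun z hz => hp z (p.mem_verts_toSubgraph.1 hz)
  exact Subgraph.le_induce_top_verts.trans (Subgraph.induce_mono_right h1)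

theorem JoinedIn.exists_induced {H : Set V} (h : JoinedIn G H) {x y : V} (hx : x ∈ H)
    (hy : y ∈ H) : ∃ p : G.Walk x y, IsInducedPath p ∧ ∀ z ∈ p.support, z ∈ H := by
  obtain ⟨p, hp⟩ := h x hx y hy
  obtain ⟨a, rfl, b, rfl, q, hq, hq', -⟩ :=
    exists_shortest_walk (H := H) (S := {x}) (T := {y}) ⟨x, rfl, y, rfl, p, hp⟩
  exact ⟨q, hq', hq⟩

/-! ### Tripods and 3-path configurations. -/

/-- The three vertices `c i` coincide. -/
def Coincide (c : Fin 3 → V) : Prop := ∀ i j, c i = c j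

/-- The three vertices `c i` form a triangle. -/
def Triangle (G : SimpleGraph V) (c : Fin 3 → V) : Prop := ∀ i j, i ≠ j → G.Adj (c i) (c j)

/-- The ways in which a vertex `x` of the `i`-th and a vertex `y` of the `j`-th path may touch at
the common end `c` of three paths. -/
def Contact (G : SimpleGraph V) (c : Fin 3 → V) (i j : Fin 3) (x y : V) : Prop :=
  (Coincide c ∧ (x = c i ∨ y = c i)) ∨ (Triangle G c ∧ x = c i ∧ y = c j)

theorem Contact.symm {c : Fin 3 → V} {i j : Fin 3} {x y : V} (h : Contact G c i j x y) :
    Contact G c j i y x := by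
  rcases h with ⟨h, h'⟩ | ⟨h, h1, h2⟩
  · exact Or.inl ⟨h, by rw [h j i]; exact h'.symm⟩
  · exact Or.inr ⟨h, h2, h1⟩

/-- A triangle has distinct vertices, so a vertex common to two arms is the common centre, and the
centre may touch anything. -/
theorem Contact.of_self {c : Fin 3 → V} {i j : Fin 3} (hij : i ≠ j) {x y : V}
    (h : Contact G c i j x x) : Contact G c i j x y := by
  rcases h with ⟨h, h'⟩ | ⟨h, h1, h2⟩
  · exact Or.inl ⟨h, Or.inl (h'.elim id id)⟩
  · exact absurd (h1.symm.trans h2) (h i j hij).ne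

/-- Three induced paths from a common vertex, or from the vertices of a triangle, which touch only
there. -/
structure IsTripod {c t : Fin 3 → V} (l : ∀ i, G.Walk (c i) (t i)) : Prop where
  induced : ∀ i, IsInducedPath (l i)
  centre : Coincide c ∨ Triangle G c
  contact : ∀ i j, i ≠ j → ∀ x ∈ (l i).support, ∀ y ∈ (l j).support, Touch G x y →
    Contact G c i j x y

/-- Each end is a single vertex or a triangle. The four combinations are a theta, a pyramid, a
pyramid with its paths reversed, and a prism. Length at least 2 meets the length requirements of all
of them. -/
theorem hasThreePathConfiguration_of_contact {c c' : Fin 3 → V} (w : ∀ i, G.Walk (c i) (c' i))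
    (hind : ∀ i, IsInducedPath (w i)) (hlen : ∀ i, 2 ≤ (w i).length)
    (hc : Coincide c ∨ Triangle G c) (hc' : Coincide c' ∨ Triangle G c')
    (h : ∀ i j, i ≠ j → ∀ x ∈ (w i).support, ∀ y ∈ (w j).support, Touch G x y →
      Contact G c i j x y ∨ Contact G c' i j x y) :
    HasThreePathConfiguration G fun i => (w i).length := by
  have key : ∀ {c : Fin 3 → V} {a : V}, (∀ i, c i = a) → ¬ Triangle G c := fun hca ht =>
    (ht 0 1 (by decide)).ne ((hca 0).trans (hca 1).symm)
  have pyramid : ∀ (a : V) (b : Fin 3 → V) (p : ∀ i, G.Walk a (b i)),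
      (∀ i, IsInducedPath (p i)) → (∀ i, 2 ≤ (p i).length) → Triangle G b →
      (∀ i j, i ≠ j → ∀ x ∈ (p i).support, ∀ y ∈ (p j).support, Touch G x y →
        Contact G (fun _ => a) i j x y ∨ Contact G b i j x y) → IsPyramid G a b p := by
    intro a b p hind hlen hb h
    have hb' : ¬ Coincide b := fun hh => key (fun i => hh i 0) hb
    have ha' : ¬ Triangle G (fun _ : Fin 3 => a) := key fun _ => rfl
    refine ⟨hind, ⟨0, fun i _ => hlen i⟩, ?_, hb, ?_⟩
    · intro i j hij x hx hy
      rcases h i j hij x hx x hy (Touch.refl x) with (h | h) | (h | h)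
      · exact h.2.elim id id
      · exact absurd h.1 ha'
      · exact absurd h.1 hb'
      · exact absurd (h.2.1.symm.trans h.2.2) (hb i j hij).ne
    · intro i j hij x hx y hy hxy
      rcases h i j hij x hx y hy (Or.inr hxy) with (h | h) | (h | h)
      · rcases h.2 with rfl | rfl
        · exact Or.inr (Or.inl ((hind j).2.mem_edges (Walk.start_mem_support _) hy hxy))
        · exact Or.inl ((hind i).2.mem_edges hx (Walk.start_mem_support _) hxy)
      · exact absurd h.1 ha'
      · exact absurd h.1 hb'
      · exact Or.inr (Or.inr h.2)
  rcases hc with hc | hc <;> rcases hc' with hc' | hc'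
  · left
    obtain ⟨a, rfl⟩ : ∃ a, c = fun _ => a := ⟨c 0, funext fun i => hc i 0⟩
    obtain ⟨b, rfl⟩ : ∃ b, c' = fun _ => b := ⟨c' 0, funext fun i => hc' i 0⟩
    refine ⟨a, b, w, ⟨hind, hlen, ?_, ?_⟩, fun _ => rfl⟩
    · intro i j hij x hx hy
      rcases h i j hij x hx x hy (Touch.refl x) with (h | h) | (h | h)
      · exact Or.inl (h.2.elim id id)
      · exact absurd h.1 (key fun _ => rfl)
      · exact Or.inr (h.2.elim id id)
      · exact absurd h.1 (key fun _ => rfl)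
    · intro i j hij x hx y hy hxy
      rcases h i j hij x hx y hy (Or.inr hxy) with (h | h) | (h | h)
      · rcases h.2 with rfl | rfl
        · exact Or.inr ((hind j).2.mem_edges (Walk.start_mem_support _) hy hxy)
        · exact Or.inl ((hind i).2.mem_edges hx (Walk.start_mem_support _) hxy)
      · exact absurd h.1 (key fun _ => rfl)
      · rcases h.2 with rfl | rfl
        · exact Or.inr ((hind j).2.mem_edges (Walk.end_mem_support _) hy hxy)
        · exact Or.inl ((hind i).2.mem_edges hx (Walk.end_mem_support _) hxy)
      · exact absurd h.1 (key fun _ => rfl)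
  · right; left
    obtain ⟨a, rfl⟩ : ∃ a, c = fun _ => a := ⟨c 0, funext fun i => hc i 0⟩
    exact ⟨a, c', w, pyramid a c' w hind hlen hc' h, fun _ => rfl⟩
  · right; left
    obtain ⟨b, rfl⟩ : ∃ b, c' = fun _ => b := ⟨c' 0, funext fun i => hc' i 0⟩
    refine ⟨b, c, fun i => (w i).reverse, pyramid b c _ (fun i => (hind i).reverse)
      (fun i => by simpa using hlen i) hc ?_, fun i => Walk.length_reverse _⟩
    intro i j hij x hx y hy hxy
    rw [Walk.support_reverse, List.mem_reverse] at hx hy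
    exact (h i j hij x hx y hy hxy).symm
  · right; right
    have hc1 : ¬ Coincide c := fun hh => key (fun i => hh i 0) hc
    have hc2 : ¬ Coincide c' := fun hh => key (fun i => hh i 0) hc'
    refine ⟨c, c', w, ⟨hind, fun i => (by have := hlen i; omega), ?_, hc, hc', ?_⟩, fun _ => rfl⟩
    · intro i j hij x hx hy
      rcases h i j hij x hx x hy (Touch.refl x) with (h | h) | (h | h)
      · exact absurd h.1 hc1
      · exact absurd (h.2.1.symm.trans h.2.2) (hc i j hij).ne
      · exact absurd h.1 hc2
      · exact absurd (h.2.1.symm.trans h.2.2) (hc' i j hij).ne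
    · intro i j hij x hx y hy hxy
      rcases h i j hij x hx y hy (Or.inr hxy) with (h | h) | (h | h)
      · exact absurd h.1 hc1
      · exact Or.inl h.2
      · exact absurd h.1 hc2
      · exact Or.inr h.2

/-- Two tripods joined by three long paths form a `3`-path configuration. -/
theorem IsTripod.hasThreePathConfiguration {c s t c' : Fin 3 → V} {l : ∀ i, G.Walk (c i) (s i)}
    {r : ∀ i, G.Walk (c' i) (t i)} (hl : IsTripod l) (hr : IsTripod r)
    (q : ∀ i, G.Walk (s i) (t i)) (hq : ∀ i, IsInducedPath (q i)) (hlen : ∀ i, 2 ≤ (q i).length)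
    (hqq : ∀ i j, i ≠ j → ∀ x ∈ (q i).support, ∀ y ∈ (q j).support, ¬ Touch G x y)
    (hlr : ∀ i j, ∀ x ∈ (l i).support, ∀ y ∈ (r j).support, ¬ Touch G x y)
    (hlq : ∀ i j, ∀ x ∈ (l i).support, ∀ y ∈ (q j).support, Touch G x y → x = s j ∨ y = s j)
    (hrq : ∀ i j, ∀ x ∈ (r i).support, ∀ y ∈ (q j).support, Touch G x y → x = t j ∨ y = t j) :
    HasThreePathConfiguration G fun i => (l i).length + (q i).length + (r i).length := by
  have mem : ∀ {i x}, x ∈ ((l i).append ((q i).append (r i).reverse)).support →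
      x ∈ (l i).support ∨ x ∈ (q i).support ∨ x ∈ (r i).support := by
    intro i x hx
    simpa only [Walk.mem_support_append_iff, Walk.support_reverse, List.mem_reverse] using hx
  -- An arm touches another connecting path only at the start of that path, which is also the leaf
  -- of another arm. The contact is thus one between two arms of the tripod.
  have arm : ∀ {c s : Fin 3 → V} {l : ∀ i, G.Walk (c i) (s i)}, IsTripod l →
      ∀ i j, i ≠ j → ∀ x ∈ (l i).support, ∀ y, Touch G x y → x = s j ∨ y = s j →
      Contact G c i j x y := by
    intro c s l hl i j hij x hx y hxy h
    rcases h with rfl | rfl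
    · exact (hl.contact i j hij _ hx _ (Walk.end_mem_support _) (Touch.refl _)).of_self hij
    · exact hl.contact i j hij _ hx _ (Walk.end_mem_support _) hxy
  have := hasThreePathConfiguration_of_contact
    (fun i => (l i).append ((q i).append (r i).reverse)) ?_ ?_ hl.centre hr.centre ?_
  · convert this using 2 with i
    simp [add_assoc]
  · intro i
    refine (hl.induced i).append ((hq i).append (hr.induced i).reverse ?_) ?_
    · intro x hx y hy hxy
      rw [Walk.support_reverse, List.mem_reverse] at hy
      exact (hrq i i y hy x hx hxy.symm).symm
    · intro x hx y hy hxy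
      rw [Walk.mem_support_append_iff, Walk.support_reverse, List.mem_reverse] at hy
      rcases hy with hy | hy
      · exact hlq i i x hx y hy hxy
      · exact absurd hxy (hlr i i x hx y hy)
  · intro i
    have := hlen i
    simp only [Walk.length_append, Walk.length_reverse]
    omega
  · intro i j hij x hx y hy hxy
    rcases mem hx with hx | hx | hx <;> rcases mem hy with hy | hy | hy
    · exact Or.inl (hl.contact i j hij x hx y hy hxy)
    · exact Or.inl (arm hl i j hij x hx y hxy (hlq i j x hx y hy hxy))
    · exact absurd hxy (hlr i j x hx y hy)
    · exact Or.inl (arm hl j i hij.symm y hy x hxy.symm (hlq j i y hy x hx hxy.symm)).symm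
    · exact absurd hxy (hqq i j hij x hx y hy)
    · exact Or.inr (arm hr j i hij.symm y hy x hxy.symm (hrq j i y hy x hx hxy.symm)).symm
    · exact absurd hxy.symm (hlr j i y hy x hx)
    · exact Or.inr (arm hr i j hij x hx y hxy (hrq i j x hx y hy hxy))
    · exact Or.inr (hr.contact i j hij x hx y hy hxy)

/-- Two arms of a tripod contain an induced path between their leaves. -/
theorem IsTripod.exists_leafPath {c t : Fin 3 → V} {l : ∀ i, G.Walk (c i) (t i)} (hl : IsTripod l)
    {i j : Fin 3} (hij : i ≠ j) : ∃ p : G.Walk (t i) (t j), IsInducedPath p ∧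
      (l j).length ≤ p.length ∧
      ∀ x, x ∈ p.support ↔ x ∈ (l i).support ∨ x ∈ (l j).support := by
  rcases hl.centre with hc | hc
  · refine ⟨(l i).reverse.append ((l j).copy (hc j i) rfl),
      (hl.induced i).reverse.append ((hl.induced j).copy _ _) ?_, by simp, ?_⟩
    · intro x hx y hy hxy
      rw [Walk.support_reverse, List.mem_reverse] at hx
      rw [Walk.support_copy] at hy
      rcases hl.contact i j hij x hx y hy hxy with h | h
      · exact h.2
      · exact absurd (hc i j) (h.1 i j hij).ne
    · intro x
      simp [Walk.mem_support_append_iff]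
  · have hn : ¬ Coincide c := fun h => (hc i j hij).ne (h i j)
    have hcon : ∀ x ∈ (l i).support, ∀ y ∈ (l j).support, Touch G x y → x = c i ∧ y = c j := by
      intro x hx y hy hxy
      rcases hl.contact i j hij x hx y hy hxy with h | h
      · exact absurd h.1 hn
      · exact h.2
    refine ⟨(l i).reverse.append (Walk.cons (hc i j hij) (l j)),
      (hl.induced i).reverse.append ((hl.induced j).cons _ ?_) ?_, by simp; omega, ?_⟩
    · intro y hy hxy
      exact (hcon _ (Walk.start_mem_support _) y hy hxy).2
    · intro x hx y hy hxy
      rw [Walk.support_reverse, List.mem_reverse] at hx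
      rw [Walk.support_cons, List.mem_cons] at hy
      rcases hy with rfl | hy
      · exact Or.inr rfl
      · exact Or.inl (hcon x hx y hy hxy).1
    · intro x
      simp only [Walk.mem_support_append_iff, Walk.support_reverse, List.mem_reverse,
        Walk.support_cons, List.mem_cons]
      constructor
      · rintro (h | rfl | h)
        · exact Or.inl h
        · exact Or.inl (Walk.start_mem_support _)
        · exact Or.inr h
      · tauto

/-- Three walks as a family indexed by `Fin 3`. -/
def tripleWalk {a₀ a₁ a₂ b₀ b₁ b₂ : V} (p₀ : G.Walk a₀ b₀) (p₁ : G.Walk a₁ b₁)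
    (p₂ : G.Walk a₂ b₂) : ∀ i : Fin 3, G.Walk (![a₀, a₁, a₂] i) (![b₀, b₁, b₂] i)
  | 0 => p₀
  | 1 => p₁
  | 2 => p₂

theorem forall_fin_three {P : Fin 3 → Prop} : (∀ i, P i) ↔ P 0 ∧ P 1 ∧ P 2 :=
  ⟨fun h => ⟨h 0, h 1, h 2⟩, fun h i => by fin_cases i <;> simp [h]⟩

theorem forall_ne_of_symm {P : Fin 3 → Fin 3 → Prop} (hs : ∀ i j, P i j → P j i)
    (h01 : P 0 1) (h02 : P 0 2) (h12 : P 1 2) : ∀ i j, i ≠ j → P i j := by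
  intro i j hij
  fin_cases i <;> fin_cases j
  · exact absurd rfl hij
  · exact h01
  · exact h02
  · exact hs _ _ h01
  · exact absurd rfl hij
  · exact h12
  · exact hs _ _ h02
  · exact hs _ _ h12
  · exact absurd rfl hij

theorem isTripod_claw {c a b u : V} {A : G.Walk c a} {B : G.Walk c b} {U : G.Walk c u}
    (hA : IsInducedPath A) (hB : IsInducedPath B) (hU : IsInducedPath U)
    (hAB : ∀ x ∈ A.support, ∀ y ∈ B.support, Touch G x y → x = c ∨ y = c)
    (hAU : ∀ x ∈ A.support, ∀ y ∈ U.support, Touch G x y → x = c ∨ y = c)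
    (hBU : ∀ x ∈ B.support, ∀ y ∈ U.support, Touch G x y → x = c ∨ y = c) :
    IsTripod (tripleWalk A B U) := by
  have hc : Coincide ![c, c, c] := by
    intro i j
    fin_cases i <;> fin_cases j <;> rfl
  refine ⟨forall_fin_three.2 ⟨hA, hB, hU⟩, Or.inl hc, forall_ne_of_symm ?_ ?_ ?_ ?_⟩
  · intro i j h x hx y hy hxy
    exact (h y hy x hx hxy.symm).symm
  · exact fun x hx y hy hxy => Or.inl ⟨hc, hAB x hx y hy hxy⟩
  · exact fun x hx y hy hxy => Or.inl ⟨hc, hAU x hx y hy hxy⟩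
  · exact fun x hx y hy hxy => Or.inl ⟨hc, hBU x hx y hy hxy⟩

theorem isTripod_triangle {c₀ c₁ c₂ a b u : V} {A : G.Walk c₀ a} {B : G.Walk c₁ b}
    {U : G.Walk c₂ u} (h01 : G.Adj c₀ c₁) (h02 : G.Adj c₀ c₂) (h12 : G.Adj c₁ c₂)
    (hA : IsInducedPath A) (hB : IsInducedPath B) (hU : IsInducedPath U)
    (hAB : ∀ x ∈ A.support, ∀ y ∈ B.support, Touch G x y → x = c₀ ∧ y = c₁)
    (hAU : ∀ x ∈ A.support, ∀ y ∈ U.support, Touch G x y → x = c₀ ∧ y = c₂)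
    (hBU : ∀ x ∈ B.support, ∀ y ∈ U.support, Touch G x y → x = c₁ ∧ y = c₂) :
    IsTripod (tripleWalk A B U) := by
  have hc : Triangle G ![c₀, c₁, c₂] :=
    forall_ne_of_symm (fun _ _ h => h.symm) h01 h02 h12
  refine ⟨forall_fin_three.2 ⟨hA, hB, hU⟩, Or.inr hc, forall_ne_of_symm ?_ ?_ ?_ ?_⟩
  · intro i j h x hx y hy hxy
    exact (h y hy x hx hxy.symm).symm
  · exact fun x hx y hy hxy => Or.inr ⟨hc, hAB x hx y hy hxy⟩
  · exact fun x hx y hy hxy => Or.inr ⟨hc, hAU x hx y hy hxy⟩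
  · exact fun x hx y hy hxy => Or.inr ⟨hc, hBU x hx y hy hxy⟩

theorem IsInducedPath.touch_take_drop {a b : V} {p : G.Walk a b} (hp : IsInducedPath p) {m n : ℕ}
    (hmn : m ≤ n) (hn : n ≤ p.length) {x y : V} (hx : x ∈ (p.take m).reverse.support)
    (hy : y ∈ (p.drop n).support) (h : Touch G x y) :
    ∃ i j, i ≤ m ∧ n ≤ j ∧ j ≤ p.length ∧ p.getVert i = x ∧ p.getVert j = y ∧
      (j = i ∨ j = i + 1) := by
  rw [Walk.support_reverse, List.mem_reverse] at hx
  obtain ⟨i, hi, hi', rfl⟩ := mem_support_take hx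
  obtain ⟨j, hj, hj', rfl⟩ := mem_support_drop hn hy
  refine ⟨i, j, hi, hj, hj', rfl, rfl, ?_⟩
  rcases (hi.trans (hmn.trans hj)).eq_or_lt with hij | hij
  · exact Or.inl hij.symm
  · exact Or.inr (hp.touch_getVert hij hj' h)

theorem exists_first_last {P : ℕ → Prop} {n : ℕ} (h : ∃ i ≤ n, P i) :
    ∃ a b, a ≤ b ∧ b ≤ n ∧ P a ∧ P b ∧ ∀ i ≤ n, P i → a ≤ i ∧ i ≤ b := by
  classical
  obtain ⟨k, hk, hPk⟩ := h
  have hex : ∃ i, P i := ⟨k, hPk⟩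
  refine ⟨Nat.find hex, Nat.findGreatest P n, ?_, Nat.findGreatest_le n, Nat.find_spec hex,
    Nat.findGreatest_spec hk hPk, fun i hi hPi => ⟨Nat.find_min' hex hPi,
      Nat.le_findGreatest hi hPi⟩⟩
  exact (Nat.find_min' hex hPk).trans (Nat.le_findGreatest hk hPk)

/-- An induced path `T` from `a` to `b` inside `H` and a vertex `u` of `H` that can be joined to
`T` inside `H` give rise to a tripod with the leaves `a`, `b` and `u`, whose arm to `u` has, up to
an error of one, the length of a shortest walk inside `H` from `u` to `T`. -/
theorem exists_tripod {H : Set V} {a b u : V} {T : G.Walk a b} (hT : IsInducedPath T)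
    (hTH : ∀ x ∈ T.support, x ∈ H)
    (hcon : ∃ v ∈ T.support, ∃ q : G.Walk u v, ∀ x ∈ q.support, x ∈ H) :
    ∃ (c : Fin 3 → V) (l : ∀ i, G.Walk (c i) (![a, b, u] i)), IsTripod l ∧
      (∀ i, ∀ x ∈ (l i).support, x ∈ H) ∧
      (∀ v ∈ T.support, ∀ q : G.Walk u v, (∀ x ∈ q.support, x ∈ H) →
        (l 2).length ≤ q.length) ∧
      ∃ v ∈ T.support, ∃ q : G.Walk u v, (∀ x ∈ q.support, x ∈ H) ∧
        q.length ≤ (l 2).length + 1 := by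
  have hA : ∀ {m}, ∀ x ∈ (T.take m).reverse.support, x ∈ H := by
    intro m x hx
    rw [Walk.support_reverse, List.mem_reverse] at hx
    exact hTH x (mem_of_mem_take hx)
  have hB : ∀ {m}, ∀ x ∈ (T.drop m).support, x ∈ H := fun {m} x hx =>
    hTH x (mem_of_mem_drop hx)
  by_cases hu : u ∈ T.support
  · obtain ⟨k, hk, rfl⟩ := exists_getVert_of_mem hu
    have hkH : T.getVert k ∈ H := hTH _ hu
    refine ⟨_, tripleWalk (T.take k).reverse (T.drop k) .nil,
      isTripod_claw (hT.take k).reverse (hT.drop k) (.nil _) ?_ ?_ ?_, ?_, ?_, ?_⟩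
    · intro x hx y hy hxy
      obtain ⟨i, j, hi, hj, -, rfl, rfl, h⟩ := hT.touch_take_drop le_rfl hk hx hy hxy
      rcases h with rfl | rfl
      · obtain rfl : j = k := by omega
        exact Or.inl rfl
      · obtain rfl | h : i = k ∨ i + 1 = k := by omega
        · exact Or.inl rfl
        · rw [h]
          exact Or.inr rfl
    · intro x hx y hy _
      exact Or.inr (by simpa using hy)
    · intro x hx y hy _
      exact Or.inr (by simpa using hy)
    · refine forall_fin_three.2 ⟨hA, hB, ?_⟩
      intro x hx
      obtain rfl : x = T.getVert k := by simpa [tripleWalk] using hx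
      exact hkH
    · intro v _ q _
      exact Nat.zero_le _
    · exact ⟨_, hu, .nil, by simpa using hkH, by simp⟩
  -- the arm to `u` follows a shortest walk to the neighbourhood of `T`
  obtain ⟨v₀, hv₀, q₀, hq₀⟩ := hcon
  obtain ⟨u, rfl, s, ⟨v₁, hv₁, hsv₁⟩, p, hpH, hp, -, hpT, hmin⟩ :=
    exists_shortest_walk (G := G) (H := H) (S := {u})
      (T := {x | ∃ v ∈ T.support, Touch G x v}) ⟨u, rfl, v₀, ⟨v₀, hv₀, Touch.refl _⟩, q₀, hq₀⟩
  have hpTouch : ∀ x ∈ p.support, ∀ y ∈ T.support, Touch G x y → x = s := fun x hx y hy hxy =>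
    hpT x hx ⟨y, hy, hxy⟩
  -- Otherwise the predecessor of `s` on `p` would already touch `T`.
  have hsT : s ∉ T.support := by
    intro hs
    have h0 : p.length ≠ 0 := fun h0 => hu (Walk.eq_of_length_eq_zero h0 ▸ hs)
    have hadj := p.adj_getVert_succ (i := p.length - 1) (by omega)
    rw [Nat.sub_add_cancel (by omega), Walk.getVert_length] at hadj
    exact hadj.ne (hpTouch _ (p.getVert_mem_support _) s hs (Or.inr hadj))
  have hadj : ∀ y ∈ T.support, Touch G s y → G.Adj s y := fun y hy h =>
    h.resolve_left fun h => hsT (h ▸ hy)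
  -- With `hup`, this says that `u` has distance exactly `p.length + 1` from `T` inside `H`. The arm
  -- to `u` will have this length or one less, depending on the centre.
  have hlow : ∀ v ∈ T.support, ∀ q : G.Walk u v, (∀ x ∈ q.support, x ∈ H) →
      p.length + 1 ≤ q.length := by
    intro v hv q hq
    have h0 : q.length ≠ 0 := fun h0 => hu (Walk.eq_of_length_eq_zero h0 ▸ hv)
    have hadj := q.adj_getVert_succ (i := q.length - 1) (by omega)
    rw [Nat.sub_add_cancel (by omega), Walk.getVert_length] at hadj
    have := hmin u rfl (q.getVert (q.length - 1)) ⟨v, hv, Or.inr hadj⟩ (q.take (q.length - 1))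
      (fun x hx => hq x (mem_of_mem_take hx))
    rw [Walk.take_length] at this
    omega
  have hup : ∃ v ∈ T.support, ∃ q : G.Walk u v, (∀ x ∈ q.support, x ∈ H) ∧
      q.length ≤ p.length + 1 := by
    obtain ⟨e, he, heS⟩ := hsv₁.exists_walk
    refine ⟨v₁, hv₁, p.append e, ?_, by rw [Walk.length_append]; omega⟩
    intro x hx
    rw [Walk.mem_support_append_iff] at hx
    rcases hx with hx | hx
    · exact hpH x hx
    · rcases heS x hx with rfl | rfl
      · exact hpH _ (Walk.end_mem_support _)
      · exact hTH _ hv₁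
  obtain ⟨α, β, hαβ, hβ, hsα, hsβ, hext⟩ : ∃ α β, α ≤ β ∧ β ≤ T.length ∧
      G.Adj s (T.getVert α) ∧ G.Adj s (T.getVert β) ∧
      ∀ i ≤ T.length, G.Adj s (T.getVert i) → α ≤ i ∧ i ≤ β := by
    obtain ⟨i, hi, rfl⟩ := exists_getVert_of_mem hv₁
    exact exists_first_last ⟨i, hi, hadj _ hv₁ hsv₁⟩
  have hpr : ∀ x ∈ p.reverse.support, x ∈ p.support := by simp
  have hpR : ∀ x ∈ p.reverse.support, x ∈ H := fun x hx => hpH x (hpr x hx)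
  -- only `s` touches the two parts of `T`, and only in their inner ends
  have hAU : ∀ x ∈ (T.take α).reverse.support, ∀ y ∈ p.reverse.support, Touch G x y →
      x = T.getVert α ∧ y = s := by
    intro x hx y hy hxy
    rw [Walk.support_reverse, List.mem_reverse] at hx
    have hxT := mem_of_mem_take hx
    obtain rfl := hpTouch y (hpr y hy) x hxT hxy.symm
    obtain ⟨i, hi, hi', rfl⟩ := mem_support_take hx
    obtain rfl : i = α := le_antisymm hi (hext i hi' (hadj _ hxT hxy.symm)).1
    exact ⟨rfl, rfl⟩
  have hBU : ∀ x ∈ (T.drop β).support, ∀ y ∈ p.reverse.support, Touch G x y →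
      x = T.getVert β ∧ y = s := by
    intro x hx y hy hxy
    have hxT := mem_of_mem_drop hx
    obtain rfl := hpTouch y (hpr y hy) x hxT hxy.symm
    obtain ⟨i, hi, hi', rfl⟩ := mem_support_drop hβ hx
    obtain rfl : i = β := le_antisymm (hext i hi' (hadj _ hxT hxy.symm)).2 hi
    exact ⟨rfl, rfl⟩
  have hlen : p.reverse.length = p.length := Walk.length_reverse p
  -- Here `α` and `β` index the first and the last neighbour of `s` on `T`. If they agree, the
  -- centre is that neighbour; if they are consecutive, the two neighbours and `s` form a triangle;
  -- otherwise `s` is the centre and the part of `T` strictly between them is dropped.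
  rcases hαβ.eq_or_lt with rfl | hlt
  · refine ⟨_, tripleWalk (T.take α).reverse (T.drop α) (.cons hsα.symm p.reverse),
      isTripod_claw (hT.take α).reverse (hT.drop α) (hp.reverse.cons _ ?_) ?_ ?_ ?_, ?_, ?_, ?_⟩
    · intro y hy hxy
      exact hpTouch y (hpr y hy) _ (T.getVert_mem_support _) hxy.symm
    · intro x hx y hy hxy
      obtain ⟨i, j, hi, hj, -, rfl, rfl, h⟩ := hT.touch_take_drop le_rfl hβ hx hy hxy
      obtain rfl | rfl : i = α ∨ j = α := by omega
      · exact Or.inl rfl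
      · exact Or.inr rfl
    · intro x hx y hy hxy
      rw [Walk.support_cons, List.mem_cons] at hy
      rcases hy with rfl | hy
      · exact Or.inr rfl
      · exact Or.inl (hAU x hx y hy hxy).1
    · intro x hx y hy hxy
      rw [Walk.support_cons, List.mem_cons] at hy
      rcases hy with rfl | hy
      · exact Or.inr rfl
      · exact Or.inl (hBU x hx y hy hxy).1
    · refine forall_fin_three.2 ⟨hA, hB, ?_⟩
      intro x hx
      replace hx : x ∈ (Walk.cons hsα.symm p.reverse).support := hx
      rw [Walk.support_cons, List.mem_cons] at hx
      rcases hx with rfl | hx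
      · exact hTH _ (T.getVert_mem_support _)
      · exact hpR x hx
    · intro v hv q hq
      have := hlow v hv q hq
      simpa [tripleWalk] using this
    · obtain ⟨v, hv, q, hq, hql⟩ := hup
      refine ⟨v, hv, q, hq, ?_⟩
      have : (Walk.cons hsα.symm p.reverse).length = p.length + 1 := by simp
      change q.length ≤ (Walk.cons hsα.symm p.reverse).length + 1
      omega
  have hlow' : ∀ v ∈ T.support, ∀ q : G.Walk u v, (∀ x ∈ q.support, x ∈ H) →
      p.reverse.length ≤ q.length := by
    intro v hv q hq
    have := hlow v hv q hq
    omega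
  have hup' : ∃ v ∈ T.support, ∃ q : G.Walk u v, (∀ x ∈ q.support, x ∈ H) ∧
      q.length ≤ p.reverse.length + 1 := by
    rwa [hlen]
  rcases (Nat.succ_le_of_lt hlt).eq_or_lt with heq | hlt'
  · have hTαβ : G.Adj (T.getVert α) (T.getVert β) := by
      rw [← heq]
      exact T.adj_getVert_succ (by omega)
    refine ⟨_, tripleWalk (T.take α).reverse (T.drop β) p.reverse,
      isTripod_triangle hTαβ hsα.symm hsβ.symm (hT.take α).reverse (hT.drop β) hp.reverse
        ?_ hAU hBU, forall_fin_three.2 ⟨hA, hB, hpR⟩, hlow', hup'⟩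
    intro x hx y hy hxy
    obtain ⟨i, j, hi, hj, -, rfl, rfl, h⟩ := hT.touch_take_drop hαβ hβ hx hy hxy
    obtain ⟨rfl, rfl⟩ : i = α ∧ j = β := by omega
    exact ⟨rfl, rfl⟩
  · have hcons : ∀ {x m y} {w : G.Walk (T.getVert m) x} {h : G.Adj s (T.getVert m)},
        y ∈ (Walk.cons h w).support → y = s ∨ y ∈ w.support := by
      intro x m y w h hy
      rwa [Walk.support_cons, List.mem_cons] at hy
    have hsH : s ∈ H := hpH s (Walk.end_mem_support _)
    refine ⟨_, tripleWalk (.cons hsα (T.take α).reverse) (.cons hsβ (T.drop β)) p.reverse,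
      isTripod_claw ((hT.take α).reverse.cons _ ?_) ((hT.drop β).cons _ ?_) hp.reverse ?_ ?_ ?_,
      forall_fin_three.2 ⟨?_, ?_, hpR⟩, hlow', hup'⟩
    · intro y hy hxy
      exact (hAU y hy s (by simp) hxy.symm).1
    · intro y hy hxy
      exact (hBU y hy s (by simp) hxy.symm).1
    · intro x hx y hy hxy
      rcases hcons hx with rfl | hx
      · exact Or.inl rfl
      rcases hcons hy with rfl | hy
      · exact Or.inr rfl
      obtain ⟨i, j, hi, hj, -, -, -, h⟩ := hT.touch_take_drop hαβ hβ hx hy hxy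
      omega
    · intro x hx y hy hxy
      rcases hcons hx with rfl | hx
      · exact Or.inl rfl
      · exact Or.inr (hAU x hx y hy hxy).2
    · intro x hx y hy hxy
      rcases hcons hx with rfl | hx
      · exact Or.inl rfl
      · exact Or.inr (hBU x hx y hy hxy).2
    · intro x hx
      rcases hcons hx with rfl | hx
      · exact hsH
      · exact hA x hx
    · intro x hx
      rcases hcons hx with rfl | hx
      · exact hsH
      · exact hB x hx

/-- `exists_tripod` controls the length of the last arm, whereas the last position of a
configuration built from rails is reserved for the detour. The swap lets the controlled arm end a
direct rail. -/
theorem IsTripod.swap {c t : Fin 3 → V} {l : ∀ i, G.Walk (c i) (t i)} (hl : IsTripod l) :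
    IsTripod (tripleWalk (l 0) (l 2) (l 1)) := by
  have hc : ∀ i, ![c 0, c 2, c 1] i = c (![0, 2, 1] i) :=
    forall_fin_three.2 ⟨rfl, rfl, rfl⟩
  have hne : ∀ i j : Fin 3, i ≠ j → (![0, 2, 1] i : Fin 3) ≠ ![0, 2, 1] j := by decide
  have hco : Coincide c → Coincide ![c 0, c 2, c 1] := fun h i j => by
    rw [hc, hc]
    exact h _ _
  have htr : Triangle G c → Triangle G ![c 0, c 2, c 1] := fun h i j hij => by
    rw [hc, hc]
    exact h _ _ (hne i j hij)
  have hcon : ∀ {i j x y}, Contact G c (![0, 2, 1] i) (![0, 2, 1] j) x y →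
      Contact G ![c 0, c 2, c 1] i j x y := by
    intro i j x y h
    rw [Contact, hc, hc]
    exact h.imp (fun h => ⟨hco h.1, h.2⟩) (fun h => ⟨htr h.1, h.2⟩)
  refine ⟨forall_fin_three.2 ⟨hl.induced 0, hl.induced 2, hl.induced 1⟩, hl.centre.imp hco htr,
    forall_ne_of_symm ?_ ?_ ?_ ?_⟩
  · intro i j h x hx y hy hxy
    exact (h y hy x hx hxy.symm).symm
  · exact fun x hx y hy hxy => hcon (hl.contact 0 2 (by decide) x hx y hy hxy)
  · exact fun x hx y hy hxy => hcon (hl.contact 0 1 (by decide) x hx y hy hxy)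
  · exact fun x hx y hy hxy => hcon (hl.contact 2 1 (by decide) x hx y hy hxy)

/-! ### Rail systems and the comparison of two configurations. -/

/-- Pairwise non-touching connected sets `B k`, called blobs, and induced paths `ρ i`, called
rails, each of which joins two blobs and touches the blobs only at its ends. -/
structure IsRailSystem {ι κ : Type*} (src tgt : ι → κ) (B : κ → Set V) {s t : ι → V}
    (ρ : ∀ i, G.Walk (s i) (t i)) : Prop where
  joined : ∀ k, JoinedIn G (B k)
  blobs_apart : ∀ k k', k ≠ k' → ∀ x ∈ B k, ∀ y ∈ B k', ¬ Touch G x y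
  src_ne_tgt : ∀ i, src i ≠ tgt i
  start_mem : ∀ i, s i ∈ B (src i)
  end_mem : ∀ i, t i ∈ B (tgt i)
  induced : ∀ i, IsInducedPath (ρ i)
  meet : ∀ k i, ∀ x ∈ B k, ∀ y ∈ (ρ i).support, Touch G x y →
    (src i = k ∧ (x = s i ∨ y = s i)) ∨ (tgt i = k ∧ (x = t i ∨ y = t i))

namespace IsRailSystem

variable {ι κ : Type*} {src tgt : ι → κ} {B : κ → Set V} {s t : ι → V}
  {ρ : ∀ i, G.Walk (s i) (t i)}

theorem two_le_length (h : IsRailSystem src tgt B ρ) (i : ι) : 2 ≤ (ρ i).length :=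
  IsInducedPath.two_le_length_of_not_touch
    (h.blobs_apart _ _ (h.src_ne_tgt i) _ (h.start_mem i) _ (h.end_mem i))

theorem meet_src (h : IsRailSystem src tgt B ρ) {k : κ} {i : ι} (hk : tgt i ≠ k) {x y : V}
    (hx : x ∈ B k) (hy : y ∈ (ρ i).support) (hxy : Touch G x y) : x = s i ∨ y = s i := by
  rcases h.meet k i x hx y hy hxy with h | h
  · exact h.2
  · exact absurd h.1 hk

theorem meet_tgt (h : IsRailSystem src tgt B ρ) {k : κ} {i : ι} (hk : src i ≠ k) {x y : V}
    (hx : x ∈ B k) (hy : y ∈ (ρ i).support) (hxy : Touch G x y) : x = t i ∨ y = t i := by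
  rcases h.meet k i x hx y hy hxy with h | h
  · exact absurd h.1 hk
  · exact h.2

theorem not_touch (h : IsRailSystem src tgt B ρ) {k : κ} {i : ι} (hk : src i ≠ k)
    (hk' : tgt i ≠ k) {x y : V} (hx : x ∈ B k) (hy : y ∈ (ρ i).support) : ¬ Touch G x y := by
  intro hxy
  rcases h.meet k i x hx y hy hxy with h | h
  · exact hk h.1
  · exact hk' h.1

/-- Two rails from the blob `a` to the blob `c` and a third connection through the blob `b`
form a `3`-path configuration together with tripods in `a` and `c`. -/
theorem hasThreePathConfiguration (h : IsRailSystem src tgt B ρ) {a b c : κ} (hab : a ≠ b)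
    (hac : a ≠ c) (hbc : b ≠ c) (e : Fin 4 → ι)
    (he : ∀ p q, p ≠ q → ∀ x ∈ (ρ (e p)).support, ∀ y ∈ (ρ (e q)).support, ¬ Touch G x y)
    (hs : src ∘ e = ![a, a, a, b]) (ht : tgt ∘ e = ![c, c, b, c])
    {o o' : Fin 3 → V} {l : ∀ i, G.Walk (o i) (![s (e 0), s (e 1), s (e 2)] i)} (hl : IsTripod l)
    (hlA : ∀ i, ∀ x ∈ (l i).support, x ∈ B a)
    {r : ∀ i, G.Walk (o' i) (![t (e 0), t (e 1), t (e 3)] i)} (hr : IsTripod r)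
    (hrC : ∀ i, ∀ x ∈ (r i).support, x ∈ B c)
    {η : G.Walk (t (e 2)) (s (e 3))} (hη : IsInducedPath η) (hηB : ∀ x ∈ η.support, x ∈ B b) :
    HasThreePathConfiguration G fun i => (l i).length + (tripleWalk (ρ (e 0)) (ρ (e 1))
      ((ρ (e 2)).append (η.append (ρ (e 3)))) i).length + (r i).length := by
  have s0 : src (e 0) = a := congrFun hs 0
  have s1 : src (e 1) = a := congrFun hs 1
  have s2 : src (e 2) = a := congrFun hs 2
  have s3 : src (e 3) = b := congrFun hs 3
  have t0 : tgt (e 0) = c := congrFun ht 0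
  have t1 : tgt (e 1) = c := congrFun ht 1
  have t2 : tgt (e 2) = b := congrFun ht 2
  have t3 : tgt (e 3) = c := congrFun ht 3
  have mem : ∀ {x}, x ∈ ((ρ (e 2)).append (η.append (ρ (e 3)))).support →
      x ∈ (ρ (e 2)).support ∨ x ∈ η.support ∨ x ∈ (ρ (e 3)).support := by
    intro x hx
    rwa [Walk.mem_support_append_iff, Walk.mem_support_append_iff] at hx
  have third : IsInducedPath ((ρ (e 2)).append (η.append (ρ (e 3)))) := by
    refine (h.induced _).append (hη.append (h.induced _) ?_) ?_
    · intro x hx y hy hxy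
      exact h.meet_src (by rw [t3]; exact hbc.symm) (hηB x hx) hy hxy
    · intro x hx y hy hxy
      rw [Walk.mem_support_append_iff] at hy
      rcases hy with hy | hy
      · exact (h.meet_tgt (by rw [s2]; exact hab) (hηB y hy) hx hxy.symm).symm
      · exact absurd hxy (he 2 3 (by decide) x hx y hy)
  refine hl.hasThreePathConfiguration hr _
    (forall_fin_three.2 ⟨h.induced _, h.induced _, third⟩)
    (forall_fin_three.2 ⟨h.two_le_length _, h.two_le_length _, ?_⟩)
    (forall_ne_of_symm ?_ ?_ ?_ ?_) ?_ ?_ ?_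
  · have := h.two_le_length (e 2)
    change 2 ≤ ((ρ (e 2)).append (η.append (ρ (e 3)))).length
    rw [Walk.length_append]
    omega
  · intro i j h x hx y hy hxy
    exact h y hy x hx hxy.symm
  · exact he 0 1 (by decide)
  · intro x hx y hy hxy
    rcases mem hy with hy | hy | hy
    · exact he 0 2 (by decide) x hx y hy hxy
    · exact h.not_touch (by rw [s0]; exact hab) (by rw [t0]; exact hbc.symm) (hηB y hy) hx hxy.symm
    · exact he 0 3 (by decide) x hx y hy hxy
  · intro x hx y hy hxy
    rcases mem hy with hy | hy | hy
    · exact he 1 2 (by decide) x hx y hy hxy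
    · exact h.not_touch (by rw [s1]; exact hab) (by rw [t1]; exact hbc.symm) (hηB y hy) hx hxy.symm
    · exact he 1 3 (by decide) x hx y hy hxy
  · intro i j x hx y hy
    exact h.blobs_apart a c hac x (hlA i x hx) y (hrC j y hy)
  · intro i
    refine forall_fin_three.2 ⟨?_, ?_, ?_⟩
    · intro x hx y hy hxy
      exact h.meet_src (by rw [t0]; exact hac.symm) (hlA i x hx) hy hxy
    · intro x hx y hy hxy
      exact h.meet_src (by rw [t1]; exact hac.symm) (hlA i x hx) hy hxy
    · intro x hx y hy hxy
      rcases mem hy with hy | hy | hy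
      · exact h.meet_src (by rw [t2]; exact hab.symm) (hlA i x hx) hy hxy
      · exact absurd hxy (h.blobs_apart a b hab x (hlA i x hx) y (hηB y hy))
      · exact absurd hxy (h.not_touch (by rw [s3]; exact hab.symm) (by rw [t3]; exact hac.symm)
          (hlA i x hx) hy)
  · intro i
    refine forall_fin_three.2 ⟨?_, ?_, ?_⟩
    · intro x hx y hy hxy
      exact h.meet_tgt (by rw [s0]; exact hac) (hrC i x hx) hy hxy
    · intro x hx y hy hxy
      exact h.meet_tgt (by rw [s1]; exact hac) (hrC i x hx) hy hxy
    · intro x hx y hy hxy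
      rcases mem hy with hy | hy | hy
      · exact absurd hxy (h.not_touch (by rw [s2]; exact hac) (by rw [t2]; exact hbc)
          (hrC i x hx) hy)
      · exact absurd hxy.symm (h.blobs_apart b c hbc y (hηB y hy) x (hrC i x hx))
      · exact h.meet_tgt (by rw [s3]; exact hbc) (hrC i x hx) hy hxy

end IsRailSystem

/-- In a rail system of the shape of the fan `U₄`, in which the rail `5` is the reverse of the rail
`0`, the lengths of the `3`-path configurations cannot be almost constant. -/
theorem IsRailSystem.not_almost_uniform {B : Fin 3 → Set V} {s t : Fin 6 → V}
    {ρ : ∀ i, G.Walk (s i) (t i)}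
    (h : IsRailSystem ![0, 0, 0, 1, 1, 1] ![1, 2, 2, 2, 2, 0] B ρ)
    (hs5 : s 5 = t 0) (ht5 : t 5 = s 0) (hlen : 3 ≤ (ρ 0).length)
    (hρ : ∀ i j, i ≠ j → ¬ (i = 0 ∧ j = 5) → ¬ (i = 5 ∧ j = 0) →
      ∀ x ∈ (ρ i).support, ∀ y ∈ (ρ j).support, ¬ Touch G x y)
    (L : ℕ) (hL : ∀ l, HasThreePathConfiguration G l → ∀ i, L ≤ l i + 1 ∧ l i ≤ L) : False := by
  have leaves : ∀ k a b u, a ∈ B k → b ∈ B k → u ∈ B k →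
      ∃ (c : Fin 3 → V) (l : ∀ i, G.Walk (c i) (![a, b, u] i)), IsTripod l ∧
        ∀ i, ∀ x ∈ (l i).support, x ∈ B k := by
    intro k a b u ha hb hu
    obtain ⟨T, hT, hTB⟩ := (h.joined k).exists_induced ha hb
    obtain ⟨c, l, hl, hlB, -⟩ := exists_tripod hT hTB
      ⟨a, T.start_mem_support, h.joined k u hu a ha⟩
    exact ⟨c, l, hl, hlB⟩
  -- The blobs `0`, `1`, `2` are X, Y, Z of the overview. The tripod `lZ` omits the leaf `t 4`,
  -- which is attached to it below.
  obtain ⟨cX, lX, hlX, hlXB⟩ := leaves 0 _ _ _ (h.start_mem 1) (h.start_mem 2) (h.start_mem 0)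
  obtain ⟨cY, lY, hlY, hlYB⟩ := leaves 1 _ _ _ (h.start_mem 3) (h.start_mem 4) (h.start_mem 5)
  obtain ⟨cZ, lZ, hlZ, hlZB⟩ := leaves 2 _ _ _ (h.end_mem 1) (h.end_mem 2) (h.end_mem 3)
  have ht4 : t 4 ∈ B 2 := h.end_mem 4
  obtain ⟨η, hη, hηl, hηB⟩ : ∃ p : G.Walk (s 5) (s 4), IsInducedPath p ∧
      (lY 1).length ≤ p.length ∧ ∀ x ∈ p.support, x ∈ B 1 := by
    obtain ⟨p, hp, hpl, hpS⟩ := hlY.exists_leafPath (i := 2) (j := 1) (by decide)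
    exact ⟨p, hp, hpl, fun x hx => ((hpS x).1 hx).elim (hlYB 2 x) (hlYB 1 x)⟩
  obtain ⟨η, hη, hηl, hηB⟩ : ∃ p : G.Walk (t 0) (s 4), IsInducedPath p ∧
      (lY 1).length ≤ p.length ∧ ∀ x ∈ p.support, x ∈ B 1 :=
    ⟨η.copy hs5 rfl, hη.copy _ _, by rwa [Walk.length_copy], by rwa [Walk.support_copy]⟩
  obtain ⟨T, hT, -, hTS⟩ := hlZ.exists_leafPath (i := 0) (j := 1) (by decide)
  have hTB : ∀ x ∈ T.support, x ∈ B 2 := fun x hx =>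
    ((hTS x).1 hx).elim (hlZB 0 x) (hlZB 1 x)
  -- `T` joins `t 1` to `t 2` through two arms of `lZ`. The walk `q` leads from `t 4` to its foot
  -- `v` on `T`, and is at most one longer than the arm of `r` to `t 4`.
  obtain ⟨c, r, hr, hrB, -, v, hv, q, hq, hql⟩ := exists_tripod hT hTB
    ⟨_, T.start_mem_support, h.joined 2 _ ht4 _ (hTB _ T.start_mem_support)⟩
  -- Upper bound for the detour from X through Y to Z along the rails `0` and `4`.
  have upper := (hL _ (h.hasThreePathConfiguration (a := 0) (b := 1) (c := 2) (by decide)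
    (by decide) (by decide) ![1, 2, 0, 4]
    (fun p q hpq => hρ _ _ (by revert p q; decide) (by revert p q; decide)
      (by revert p q; decide))
    (by decide) (by decide) hlX hlXB hr hrB hη hηB) 2).2
  -- Lower bound for the path along rail `4` in the configuration between Y and Z whose detour uses
  -- the rails `5` and `d`. As `v` lies on `T'`, the arm to `t 4` is at most as long as `q`.
  have lower : ∀ d : Fin 6, (d = 1 ∨ d = 2) → ∀ (T' : G.Walk (t 3) (t d)), IsInducedPath T' →
      (∀ x ∈ T'.support, x ∈ B 2) → v ∈ T'.support → ∀ (η' : G.Walk (s 0) (s d)),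
      IsInducedPath η' → (∀ x ∈ η'.support, x ∈ B 0) →
      L ≤ (lY 1).length + (ρ 4).length + q.length + 1 := by
    intro d hd T' hT' hT'B hvT' η' hη' hη'B
    obtain ⟨c', r', hr', hr'B, hmin, -⟩ := exists_tripod hT' hT'B ⟨v, hvT', q, hq⟩
    have hmin' := hmin v hvT' q hq
    obtain ⟨η'', hη'', hη''B⟩ : ∃ p : G.Walk (t 5) (s d), IsInducedPath p ∧
        ∀ x ∈ p.support, x ∈ B 0 :=
      ⟨η'.copy ht5.symm rfl, hη'.copy _ _, by rwa [Walk.support_copy]⟩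
    have := (hL _ (h.hasThreePathConfiguration (a := 1) (b := 0) (c := 2) (by decide)
      (by decide) (by decide) ![3, 4, 5, d]
      (fun p q hpq => hρ _ _ (by rcases hd with rfl | rfl <;> revert p q <;> decide)
        (by rcases hd with rfl | rfl <;> revert p q <;> decide)
        (by rcases hd with rfl | rfl <;> revert p q <;> decide))
      (by rcases hd with rfl | rfl <;> decide) (by rcases hd with rfl | rfl <;> decide)
      hlY hlYB hr'.swap (forall_fin_three.2 ⟨hr'B 0, hr'B 2, hr'B 1⟩) hη'' hη''B) 1).1
    change L ≤ (lY 1).length + (ρ 4).length + (r' 2).length + 1 at this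
    omega
  have lower' : L ≤ (lY 1).length + (ρ 4).length + q.length + 1 := by
    -- The choice of `d` depends on which arm of `lZ` contains `v`: the path in `lZ` from `t 3` to
    -- the leaf of that arm runs through `v`.
    rcases (hTS v).1 hv with hv | hv
    · obtain ⟨T', hT', -, hT'S⟩ := hlZ.exists_leafPath (i := 2) (j := 0) (by decide)
      obtain ⟨η', hη', -, hη'S⟩ := hlX.exists_leafPath (i := 2) (j := 0) (by decide)
      exact lower 1 (by decide) T' hT'
        (fun x hx => ((hT'S x).1 hx).elim (hlZB 2 x) (hlZB 0 x)) ((hT'S v).2 (Or.inr hv))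
        η' hη' (fun x hx => ((hη'S x).1 hx).elim (hlXB 2 x) (hlXB 0 x))
    · obtain ⟨T', hT', -, hT'S⟩ := hlZ.exists_leafPath (i := 2) (j := 1) (by decide)
      obtain ⟨η', hη', -, hη'S⟩ := hlX.exists_leafPath (i := 2) (j := 1) (by decide)
      exact lower 2 (by decide) T' hT'
        (fun x hx => ((hT'S x).1 hx).elim (hlZB 2 x) (hlZB 1 x)) ((hT'S v).2 (Or.inr hv))
        η' hη' (fun x hx => ((hη'S x).1 hx).elim (hlXB 2 x) (hlXB 1 x))
  -- Since `η` is at least as long as the arm `lY 1` and `q.length ≤ (r 2).length + 1`, the two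
  -- bounds leave at most 2 for the length of rail `0`.
  change (lX 2).length + ((ρ 0).append (η.append (ρ 4))).length + (r 2).length ≤ L
    at upper
  simp only [Walk.length_append] at upper
  omega

/-! ### Rails cut out of connected sets. -/

/-- A connected set that meets `A` and `B` contains an induced path from the neighbourhood of `A`
to the neighbourhood of `B`, only the ends of which touch `A` and `B`. -/
theorem JoinedIn.exists_rail {R A B : Set V} (hR : JoinedIn G R) (hA : (A ∩ R).Nonempty)
    (hB : (B ∩ R).Nonempty) :
    ∃ (s t : V) (ρ : G.Walk s t), IsInducedPath ρ ∧ (∀ x ∈ ρ.support, x ∈ R) ∧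
      (∃ x ∈ A, Touch G x s) ∧ (∃ x ∈ B, Touch G x t) ∧
      (∀ x ∈ A, ∀ y ∈ ρ.support, Touch G x y → y = s) ∧
      ∀ x ∈ B, ∀ y ∈ ρ.support, Touch G x y → y = t := by
  obtain ⟨a, haA, haR⟩ := hA
  obtain ⟨b, hbB, hbR⟩ := hB
  obtain ⟨p, hp⟩ := hR a haR b hbR
  obtain ⟨s, hs, t, ht, ρ, hρR, hρ, h1, h2, -⟩ := exists_shortest_walk (G := G) (H := R)
    (S := {y | ∃ x ∈ A, Touch G x y}) (T := {y | ∃ x ∈ B, Touch G x y})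
    ⟨a, ⟨a, haA, Touch.refl a⟩, b, ⟨b, hbB, Touch.refl b⟩, p, hp⟩
  exact ⟨s, t, ρ, hρ, hρR, hs, ht, fun x hx y hy hxy => h1 y hy ⟨x, hx, hxy⟩,
    fun x hx y hy hxy => h2 y hy ⟨x, hx, hxy⟩⟩

theorem JoinedIn.of_touch {H K : Set V} (hH : JoinedIn G H) (hHK : H ⊆ K)
    (h : ∀ x ∈ K, ∃ y ∈ H, Touch G y x) : JoinedIn G K := by
  intro x hx y hy
  obtain ⟨x', hx', hxx'⟩ := h x hx
  obtain ⟨y', hy', hyy'⟩ := h y hy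
  obtain ⟨p, hp⟩ := hH x' hx' y' hy'
  obtain ⟨e, -, he⟩ := hxx'.symm.exists_walk
  obtain ⟨f, -, hf⟩ := hyy'.exists_walk
  refine ⟨e.append (p.append f), fun z hz => ?_⟩
  rw [Walk.mem_support_append_iff, Walk.mem_support_append_iff] at hz
  rcases hz with hz | hz | hz
  · rcases he z hz with rfl | rfl
    exacts [hx, hHK hx']
  · exact hHK (hp z hz)
  · rcases hf z hz with rfl | rfl
    exacts [hHK hy', hy]

/-- Blobs that are only adjacent to the ends of the rails become a rail system when these ends are
added to them. -/
theorem isRailSystem_insert_ends {ι κ : Type*} {src tgt : ι → κ} {B : κ → Set V} {s t : ι → V}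
    {ρ : ∀ i, G.Walk (s i) (t i)} (hB : ∀ k, JoinedIn G (B k))
    (hBB : ∀ k k', k ≠ k' → ∀ x ∈ B k, ∀ y ∈ B k', ¬ Touch G x y)
    (hne : ∀ i, src i ≠ tgt i) (hρ : ∀ i, IsInducedPath (ρ i))
    (hρρ : ∀ i j, i ≠ j → ∀ x ∈ (ρ i).support, ∀ y ∈ (ρ j).support, ¬ Touch G x y)
    (hst : ∀ i, ¬ Touch G (s i) (t i)) (hs : ∀ i, ∃ x ∈ B (src i), Touch G x (s i))
    (ht : ∀ i, ∃ x ∈ B (tgt i), Touch G x (t i))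
    (hmeet : ∀ k i, ∀ x ∈ B k, ∀ y ∈ (ρ i).support, Touch G x y →
      (src i = k ∧ y = s i) ∨ (tgt i = k ∧ y = t i)) :
    IsRailSystem src tgt
      (fun k => B k ∪ {x | ∃ i, (src i = k ∧ x = s i) ∨ (tgt i = k ∧ x = t i)}) ρ := by
  have hmem : ∀ i x, x = s i ∨ x = t i → x ∈ (ρ i).support := by
    rintro i x (rfl | rfl)
    exacts [Walk.start_mem_support _, Walk.end_mem_support _]
  have hmeet' : ∀ k i, ∀ x ∈ B k ∪ {x | ∃ i, (src i = k ∧ x = s i) ∨ (tgt i = k ∧ x = t i)},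
      ∀ y ∈ (ρ i).support, Touch G x y →
      (src i = k ∧ (x = s i ∨ y = s i)) ∨ (tgt i = k ∧ (x = t i ∨ y = t i)) := by
    rintro k i x (hx | ⟨j, hj⟩) y hy hxy
    · exact (hmeet k i x hx y hy hxy).imp (fun h => ⟨h.1, Or.inr h.2⟩)
        (fun h => ⟨h.1, Or.inr h.2⟩)
    -- Different rails do not touch, so an added end that touches rail `i` is an end of rail `i`
    -- itself.
    · obtain rfl : j = i := by
        by_contra hji
        exact hρρ j i hji x (hmem j x (hj.imp And.right And.right)) y hy hxy
      exact hj.imp (fun h => ⟨h.1, Or.inl h.2⟩) (fun h => ⟨h.1, Or.inl h.2⟩)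
  refine ⟨?_, ?_, hne, fun i => Or.inr ⟨i, Or.inl ⟨rfl, rfl⟩⟩,
    fun i => Or.inr ⟨i, Or.inr ⟨rfl, rfl⟩⟩, hρ, hmeet'⟩
  · intro k
    refine (hB k).of_touch Set.subset_union_left ?_
    rintro x (hx | ⟨i, ⟨rfl, rfl⟩ | ⟨rfl, rfl⟩⟩)
    exacts [⟨x, hx, Touch.refl x⟩, hs i, ht i]
  · have key : ∀ k k', k ≠ k' → ∀ x ∈ B k, ∀ i y,
        (src i = k' ∧ y = s i) ∨ (tgt i = k' ∧ y = t i) → ¬ Touch G x y := by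
      intro k k' hk x hx i y hy hxy
      rcases hmeet k i x hx y (hmem i y (hy.imp And.right And.right)) hxy with ⟨h, h'⟩ | ⟨h, h'⟩ <;>
        rcases hy with ⟨h1, h2⟩ | ⟨h1, h2⟩
      · exact hk (h.symm.trans h1)
      · exact hst i (Or.inl (h'.symm.trans h2))
      · exact hst i (Or.inl (h2.symm.trans h'))
      · exact hk (h.symm.trans h1)
    rintro k k' hk x (hx | ⟨i, hx⟩) y (hy | ⟨j, hy⟩) hxy
    · exact hBB k k' hk x hx y hy hxy
    · exact key k k' hk x hx j y hy hxy
    · exact key k' k hk.symm y hy i x hx hxy.symm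
    · obtain rfl : i = j := by
        by_contra hij
        exact hρρ i j hij x (hmem i x (hx.imp And.right And.right)) y
          (hmem j y (hy.imp And.right And.right)) hxy
      rcases hx with ⟨h, rfl⟩ | ⟨h, rfl⟩ <;> rcases hy with ⟨h1, rfl⟩ | ⟨h1, rfl⟩
      · exact hk (h.symm.trans h1)
      · exact hst i hxy
      · exact hst i hxy.symm
      · exact hk (h.symm.trans h1)

/-- The rail between the first two blobs is traversed in opposite directions by the two detours; a
reversed copy is added as a sixth rail so that both fit the same oriented statement. -/
theorem IsRailSystem.not_almost_uniform_of_fan {B : Fin 3 → Set V} {s t : Fin 5 → V}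
    {ρ : ∀ i, G.Walk (s i) (t i)}
    (h : IsRailSystem ![0, 0, 0, 1, 1] ![1, 2, 2, 2, 2] B ρ) (hlen : 3 ≤ (ρ 0).length)
    (hρ : ∀ i j, i ≠ j → ∀ x ∈ (ρ i).support, ∀ y ∈ (ρ j).support, ¬ Touch G x y)
    (L : ℕ) (hL : ∀ l, HasThreePathConfiguration G l → ∀ i, L ≤ l i + 1 ∧ l i ≤ L) : False := by
  have all : ∀ {P : Fin 6 → Prop}, P 0 → P 1 → P 2 → P 3 → P 4 → P 5 → ∀ i, P i := by
    intro P h0 h1 h2 h3 h4 h5 i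
    fin_cases i
    exacts [h0, h1, h2, h3, h4, h5]
  let ρ' : ∀ i : Fin 6, G.Walk (![s 0, s 1, s 2, s 3, s 4, t 0] i)
      (![t 0, t 1, t 2, t 3, t 4, s 0] i) := fun i =>
    match i with
    | 0 => ρ 0
    | 1 => ρ 1
    | 2 => ρ 2
    | 3 => ρ 3
    | 4 => ρ 4
    | 5 => (ρ 0).reverse
  have hsupp : ∀ i x, x ∈ (ρ' i).support → x ∈ (ρ (![0, 1, 2, 3, 4, 0] i)).support :=
    all (fun _ h => h) (fun _ h => h) (fun _ h => h) (fun _ h => h) (fun _ h => h) (by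
      intro x hx
      change x ∈ (ρ 0).reverse.support at hx
      rwa [Walk.support_reverse, List.mem_reverse] at hx)
  have h' : IsRailSystem ![0, 0, 0, 1, 1, 1] ![1, 2, 2, 2, 2, 0] B ρ' := by
    refine ⟨h.joined, h.blobs_apart, by decide, ?_, ?_, ?_, fun k => ?_⟩
    · exact all (h.start_mem 0) (h.start_mem 1) (h.start_mem 2) (h.start_mem 3) (h.start_mem 4)
        (h.end_mem 0)
    · exact all (h.end_mem 0) (h.end_mem 1) (h.end_mem 2) (h.end_mem 3) (h.end_mem 4)
        (h.start_mem 0)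
    · exact all (h.induced 0) (h.induced 1) (h.induced 2) (h.induced 3) (h.induced 4)
        (h.induced 0).reverse
    · refine all (h.meet k 0) (h.meet k 1) (h.meet k 2) (h.meet k 3) (h.meet k 4) ?_
      intro x hx y hy hxy
      exact (h.meet k 0 x hx y (hsupp 5 y hy) hxy).symm
  refine h'.not_almost_uniform rfl rfl hlen ?_ L hL
  intro i j hij h1 h2 x hx y hy
  exact hρ _ _ (by clear hx hy; revert i j; decide) x (hsupp i x hx) y (hsupp j y hy)

theorem FarApart.not_touch {K : ℕ} (hK : 2 ≤ K) {X Y : Set V} (h : FarApart G K X Y) {x y : V}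
    (hx : x ∈ X) (hy : y ∈ Y) : ¬ Touch G x y := by
  intro hxy
  obtain ⟨p, hp, -⟩ := hxy.exists_walk
  have := (h x hx y hy).trans (edist_le p)
  have : K ≤ p.length := by exact_mod_cast this
  omega

theorem FarApart.le_length {K : ℕ} {X Y : Set V} (h : FarApart G K X Y) {s t : V}
    (hs : ∃ x ∈ X, Touch G x s) (ht : ∃ y ∈ Y, Touch G y t) (p : G.Walk s t) :
    K ≤ p.length + 2 := by
  obtain ⟨x, hx, hxs⟩ := hs
  obtain ⟨y, hy, hyt⟩ := ht
  obtain ⟨e, he, -⟩ := hxs.exists_walk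
  obtain ⟨f, hf, -⟩ := hyt.symm.exists_walk
  have := (h x hx y hy).trans (edist_le (e.append (p.append f)))
  have : K ≤ (e.append (p.append f)).length := by exact_mod_cast this
  rw [Walk.length_append, Walk.length_append] at this
  omega

theorem FarApart.symm {K : ℕ} {X Y : Set V} (h : FarApart G K X Y) : FarApart G K Y X := by
  intro y hy x hx
  rw [edist_comm]
  exact h x hx y hy

/-! ### Fat models of the fan as rail systems. -/

/-- The edges of the fan `U₄`: the spokes, and the edges of the path. -/
def fanEdge : Fin 4 ⊕ Fin 3 → Sym2 (Option (Fin 4)) :=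
  Sum.elim (fun i => s(none, some i)) fun i => s(some i.castSucc, some i.succ)

theorem fanEdge_mem (e : Fin 4 ⊕ Fin 3) : fanEdge e ∈ (fan 4).edgeSet := by
  rcases e with i | i
  · exact trivial
  · change (pathGraph 4).Adj i.castSucc i.succ
    rw [pathGraph_adj]
    exact Or.inl rfl

theorem fanEdge_injective : Function.Injective fanEdge := by
  unfold fanEdge
  decide

theorem exists_fanEdge {e : Sym2 (Option (Fin 4))} (he : e ∈ (fan 4).edgeSet) :
    ∃ f, fanEdge f = e := by
  induction e with
  | h a b =>
    rcases a with _ | i <;> rcases b with _ | j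
    · exact absurd he (by simp)
    · exact ⟨Sum.inl j, rfl⟩
    · exact ⟨Sum.inl i, Sym2.eq_swap⟩
    · replace he : (pathGraph 4).Adj i j := he
      rw [pathGraph_adj] at he
      rcases he with he | he
      · refine ⟨Sum.inr ⟨i, by omega⟩, ?_⟩
        simp only [fanEdge, Sum.elim_inr]
        congr 3
        exact Fin.ext he
      · refine ⟨Sum.inr ⟨j, by omega⟩, ?_⟩
        rw [Sym2.eq_swap]
        simp only [fanEdge, Sum.elim_inr]
        congr 3
        exact Fin.ext he

/-- Two different members of a model of the fan `U₄` that have to be far from each other. -/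
def separated : Option (Fin 4) ⊕ (Fin 4 ⊕ Fin 3) → Option (Fin 4) ⊕ (Fin 4 ⊕ Fin 3) → Bool
  | .inl w, .inl w' => decide (w ≠ w')
  | .inl w, .inr e => decide (w ∉ fanEdge e)
  | .inr e, .inl w => decide (w ∉ fanEdge e)
  | .inr e, .inr e' => decide (e ≠ e')

/-- The vertex sets of the members of a model of the fan `U₄`. -/
def FatMinorModel.piece {K : ℕ} (M : FatMinorModel K (fan 4) G) :
    Option (Fin 4) ⊕ (Fin 4 ⊕ Fin 3) → Set V
  | .inl w => (M.branchSet w).verts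
  | .inr e => (M.branchPath ⟨fanEdge e, fanEdge_mem e⟩).verts

namespace FatMinorModel

variable {K : ℕ} (M : FatMinorModel K (fan 4) G)

theorem piece_far {l l' : Option (Fin 4) ⊕ (Fin 4 ⊕ Fin 3)} (h : separated l l' = true) :
    FarApart G K (M.piece l) (M.piece l') := by
  rcases l with w | e <;> rcases l' with w' | e' <;> simp only [separated, decide_eq_true_eq] at h
  · exact M.far_set_set w w' h
  · exact M.far_set_path w ⟨_, fanEdge_mem e'⟩ h
  · exact (M.far_set_path w' ⟨_, fanEdge_mem e⟩ h).symm
  · exact M.far_path_path _ _ fun he => h (fanEdge_injective (congrArg Subtype.val he))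

theorem piece_joined (l : Option (Fin 4) ⊕ (Fin 4 ⊕ Fin 3)) : JoinedIn G (M.piece l) := by
  rcases l with w | e
  · exact JoinedIn.of_connected (M.branchSet_connected w)
  · exact JoinedIn.of_connected (M.branchPath_connected _)

theorem piece_inter {w : Option (Fin 4)} {e : Fin 4 ⊕ Fin 3} (h : w ∈ fanEdge e) :
    (M.piece (.inl w) ∩ M.piece (.inr e)).Nonempty :=
  M.incident w ⟨_, fanEdge_mem e⟩ h

end FatMinorModel

/-- If the lengths of the `3`-path configurations of a graph are almost constant, then the graph
does not contain the fan `U₄` as a `10`-fat minor. -/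
theorem not_hasFatMinor_of_almost_uniform (L : ℕ)
    (hL : ∀ l, HasThreePathConfiguration G l → ∀ i, L ≤ l i + 1 ∧ l i ≤ L) :
    ¬ HasFatMinor 10 (fan 4) G := by
  rintro ⟨M⟩
  -- The blobs come from the two inner path vertices and the hub. The rails `1` and `4` run through
  -- the branch sets of the outer path vertices; the others each use a single edge of the fan.
  let blob : Fin 3 → Option (Fin 4) ⊕ (Fin 4 ⊕ Fin 3) :=
    ![.inl (some 1), .inl (some 2), .inl none]
  let lab : Fin 5 → List (Option (Fin 4) ⊕ (Fin 4 ⊕ Fin 3)) :=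
    ![[.inr (.inr 1)], [.inr (.inr 0), .inl (some 0), .inr (.inl 0)], [.inr (.inl 1)],
      [.inr (.inl 2)], [.inr (.inr 2), .inl (some 3), .inr (.inl 3)]]
  let src : Fin 5 → Fin 3 := ![0, 0, 0, 1, 1]
  let tgt : Fin 5 → Fin 3 := ![1, 2, 2, 2, 2]
  have hcon : ∀ i, ∃ R : Set V, JoinedIn G R ∧ (M.piece (blob (src i)) ∩ R).Nonempty ∧
      (M.piece (blob (tgt i)) ∩ R).Nonempty ∧ ∀ x ∈ R, ∃ l ∈ lab i, x ∈ M.piece l := by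
    have single : ∀ i e, lab i = [.inr e] →
        (M.piece (blob (src i)) ∩ M.piece (.inr e)).Nonempty →
        (M.piece (blob (tgt i)) ∩ M.piece (.inr e)).Nonempty →
        ∃ R : Set V, JoinedIn G R ∧ (M.piece (blob (src i)) ∩ R).Nonempty ∧
        (M.piece (blob (tgt i)) ∩ R).Nonempty ∧ ∀ x ∈ R, ∃ l ∈ lab i, x ∈ M.piece l := by
      intro i e he h1 h2
      exact ⟨_, M.piece_joined _, h1, h2, fun x hx => ⟨_, by rw [he]; exact .head _, hx⟩⟩
    have triple : ∀ i e w e', lab i = [.inr e, .inl w, .inr e'] →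
        (M.piece (blob (src i)) ∩ M.piece (.inr e)).Nonempty →
        (M.piece (blob (tgt i)) ∩ M.piece (.inr e')).Nonempty → w ∈ fanEdge e → w ∈ fanEdge e' →
        ∃ R : Set V, JoinedIn G R ∧ (M.piece (blob (src i)) ∩ R).Nonempty ∧
        (M.piece (blob (tgt i)) ∩ R).Nonempty ∧ ∀ x ∈ R, ∃ l ∈ lab i, x ∈ M.piece l := by
      intro i e w e' he h1 h2 hwe hwe'
      refine ⟨(M.piece (.inl w) ∪ M.piece (.inr e)) ∪ M.piece (.inr e'),
        ((M.piece_joined _).union (M.piece_joined _) (M.piece_inter hwe)).union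
          (M.piece_joined _) ?_, ?_, ?_, ?_⟩
      · exact (M.piece_inter hwe').mono fun x hx => ⟨Or.inl hx.1, hx.2⟩
      · exact h1.mono fun x hx => ⟨hx.1, Or.inl (Or.inr hx.2)⟩
      · exact h2.mono fun x hx => ⟨hx.1, Or.inr hx.2⟩
      · rw [he]
        rintro x ((hx | hx) | hx)
        exacts [⟨_, by simp, hx⟩, ⟨_, by simp, hx⟩, ⟨_, by simp, hx⟩]
    intro i
    fin_cases i
    · exact single 0 (.inr 1) rfl (M.piece_inter (by decide)) (M.piece_inter (by decide))
    · exact triple 1 (.inr 0) (some 0) (.inl 0) rfl (M.piece_inter (by decide))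
        (M.piece_inter (by decide)) (by decide) (by decide)
    · exact single 2 (.inl 1) rfl (M.piece_inter (by decide)) (M.piece_inter (by decide))
    · exact single 3 (.inl 2) rfl (M.piece_inter (by decide)) (M.piece_inter (by decide))
    · exact triple 4 (.inr 2) (some 3) (.inl 3) rfl (M.piece_inter (by decide))
        (M.piece_inter (by decide)) (by decide) (by decide)
  choose R hR hRs hRt hRlab using hcon
  choose s t ρ hρ hρR hs ht hms hmt using fun i => (hR i).exists_rail (hRs i) (hRt i)
  have hlab : ∀ i x, x ∈ (ρ i).support → ∃ l ∈ lab i, x ∈ M.piece l := fun i x hx =>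
    hRlab i x (hρR i x hx)
  have hρρ : ∀ i j, i ≠ j → ∀ x ∈ (ρ i).support, ∀ y ∈ (ρ j).support, ¬ Touch G x y := by
    intro i j hij x hx y hy
    obtain ⟨l, hl, hxl⟩ := hlab i x hx
    obtain ⟨l', hl', hyl'⟩ := hlab j y hy
    have : ∀ i j, i ≠ j → ∀ l ∈ lab i, ∀ l' ∈ lab j, separated l l' = true := by decide
    exact (M.piece_far (this i j hij l hl l' hl')).not_touch (by norm_num) hxl hyl'
  have hfar : ∀ i, FarApart G 10 (M.piece (blob (src i))) (M.piece (blob (tgt i))) := by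
    have : ∀ i, separated (blob (src i)) (blob (tgt i)) = true := by decide
    exact fun i => M.piece_far (this i)
  have hst : ∀ i, ¬ Touch G (s i) (t i) := by
    intro i h
    obtain ⟨p, hp, -⟩ := h.exists_walk
    have := (hfar i).le_length (hs i) (ht i) p
    omega
  have hmeet : ∀ k i, ∀ x ∈ M.piece (blob k), ∀ y ∈ (ρ i).support, Touch G x y →
      (src i = k ∧ y = s i) ∨ (tgt i = k ∧ y = t i) := by
    intro k i x hx y hy hxy
    by_cases h1 : src i = k
    · subst h1
      exact Or.inl ⟨rfl, hms i x hx y hy hxy⟩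
    by_cases h2 : tgt i = k
    · subst h2
      exact Or.inr ⟨rfl, hmt i x hx y hy hxy⟩
    obtain ⟨l, hl, hyl⟩ := hlab i y hy
    have : ∀ k i, src i ≠ k → tgt i ≠ k → ∀ l ∈ lab i, separated (blob k) l = true := by decide
    exact absurd hxy ((M.piece_far (this k i h1 h2 l hl)).not_touch (by norm_num) hx hyl)
  have sys := isRailSystem_insert_ends (src := src) (tgt := tgt) (fun k => M.piece_joined (blob k))
    (fun k k' hk x hx y hy => by
      have : ∀ k k', k ≠ k' → separated (blob k) (blob k') = true := by decide
      exact (M.piece_far (this k k' hk)).not_touch (by norm_num) hx hy)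
    (by decide) hρ hρρ hst hs ht hmeet
  refine sys.not_almost_uniform_of_fan ?_ hρρ L hL
  -- Distance 10 between the branch sets, less one step at each end, leaves length at least 8.
  have := (hfar 0).le_length (hs 0) (ht 0) (ρ 0)
  omega

/-! ### Holes in 3-path configurations. -/

/-- Two induced paths whose first vertices and whose last vertices are adjacent, and which do not
touch otherwise, form a hole. -/
theorem hasHole_of_paths {a b a' b' : V} {p : G.Walk a b} {q : G.Walk a' b'}
    (hp : IsInducedPath p) (hq : IsInducedPath q) (ha : G.Adj a a') (hb : G.Adj b b')
    (h : ∀ x ∈ p.support, ∀ y ∈ q.support, Touch G x y → (x = a ∧ y = a') ∨ (x = b ∧ y = b'))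
    (hlen : 2 ≤ p.length + q.length) : HasHole G (p.length + q.length + 2) := by
  set n := p.length + q.length + 2 with hn
  -- The cycle runs forwards along `p` and then backwards along `q`.
  set F : ℕ → V := fun i => if i ≤ p.length then p.getVert i else
    q.getVert (p.length + q.length + 1 - i) with hF
  have F1 : ∀ i, i ≤ p.length → F i = p.getVert i := fun i hi => if_pos hi
  have F2 : ∀ i, p.length < i → F i = q.getVert (p.length + q.length + 1 - i) := fun i hi =>
    if_neg (by omega)
  have hadj : ∀ i, i + 1 < n → G.Adj (F i) (F (i + 1)) := by
    intro i hi
    rcases lt_trichotomy i p.length with h1 | h1 | h1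
    · rw [F1 _ (by omega), F1 _ (by omega)]
      exact p.adj_getVert_succ h1
    · rw [F1 _ (by omega), F2 _ (by omega), h1, Walk.getVert_length,
        show p.length + q.length + 1 - (p.length + 1) = q.length by omega, Walk.getVert_length]
      exact hb
    · rw [F2 _ (by omega), F2 _ (by omega), show p.length + q.length + 1 - i =
        p.length + q.length + 1 - (i + 1) + 1 by omega]
      exact (q.adj_getVert_succ (by omega)).symm
  have hadj0 : G.Adj (F 0) (F (n - 1)) := by
    rw [F1 _ (by omega), F2 _ (by omega), Walk.getVert_zero,
      show p.length + q.length + 1 - (n - 1) = 0 by omega, Walk.getVert_zero]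
    exact ha
  have htouch : ∀ i j, i < j → j < n → Touch G (F i) (F j) → j = i + 1 ∨ (i = 0 ∧ j = n - 1) := by
    intro i j hij hj ht
    by_cases h1 : j ≤ p.length
    · rw [F1 _ (by omega), F1 _ h1] at ht
      exact Or.inl (hp.touch_getVert hij h1 ht)
    by_cases h2 : i ≤ p.length
    · rw [F1 _ h2, F2 _ (by omega)] at ht
      rcases h _ (p.getVert_mem_support _) _ (q.getVert_mem_support _) ht with ⟨h3, h4⟩ | ⟨h3, h4⟩
      · have h5 := hp.getVert_inj (j := 0) h2 (by omega) (h3.trans p.getVert_zero.symm)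
        have h6 := hq.getVert_inj (j := 0) (by omega) (by omega) (h4.trans q.getVert_zero.symm)
        omega
      · have h5 := hp.getVert_inj h2 le_rfl (h3.trans p.getVert_length.symm)
        have h6 := hq.getVert_inj (by omega) le_rfl (h4.trans q.getVert_length.symm)
        omega
    · rw [F2 _ (by omega), F2 _ (by omega)] at ht
      have := hq.touch_getVert (by omega) (by omega) ht.symm
      omega
  have hne : ∀ i j, i < j → j < n → F i ≠ F j := by
    intro i j hij hj he
    rcases htouch i j hij hj (Or.inl he) with rfl | ⟨rfl, rfl⟩
    · exact (hadj i hj).ne he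
    · exact hadj0.ne he
  have hcyc : ∀ i j : Fin n, i < j →
      (G.Adj (F i) (F j) ↔ (cycleGraph n).Adj i j) := by
    intro i j hij
    have hij' : (i : ℕ) < j := hij
    have hj := j.isLt
    -- Subtraction in `Fin n` is modulo `n`, so for `i < j` the difference `i - j` wraps around.
    have e1 : ((j - i : Fin n) : ℕ) = j - i := Fin.sub_val_of_le hij.le
    have e2 : ((i - j : Fin n) : ℕ) = n + i - j := Fin.coe_sub_iff_lt.2 hij
    rw [cycleGraph_adj', e1, e2]
    constructor
    · intro h
      have := htouch i j hij' hj (Or.inr h)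
      omega
    · intro h
      obtain h | ⟨h, h'⟩ : (j : ℕ) = i + 1 ∨ ((i : ℕ) = 0 ∧ (j : ℕ) = n - 1) := by omega
      · rw [h]
        exact hadj i (by omega)
      · rw [h, h']
        exact hadj0
  refine ⟨by omega, ⟨⟨⟨fun i => F i, ?_⟩, ?_⟩⟩⟩
  · intro i j hij
    rcases lt_trichotomy i j with h1 | h1 | h1
    · exact absurd hij (hne i j h1 j.isLt)
    · exact h1
    · exact absurd hij.symm (hne j i h1 i.isLt)
  · intro i j
    change G.Adj (F i) (F j) ↔ _
    rcases lt_trichotomy i j with h1 | h1 | h1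
    · exact hcyc i j h1
    · subst h1
      simp
    · rw [G.adj_comm, (cycleGraph n).adj_comm]
      exact hcyc j i h1

theorem IsTheta.hasHole {a b : V} {P : Fin 3 → G.Walk a b} (h : IsTheta G a b P) {i j : Fin 3}
    (hij : i ≠ j) : HasHole G ((P i).length + (P j).length) := by
  have hi := h.two_le_length i
  have hj := h.two_le_length j
  -- The hole consists of all of `P i` and the interior of `P j`.
  have hlen : (((P j).drop 1).take ((P j).length - 2)).length = (P j).length - 2 := by
    rw [Walk.take_length, Walk.drop_length]
    omega
  have := hasHole_of_paths (h.induced i) (((h.induced j).drop 1).take ((P j).length - 2))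
    (by simpa using (P j).adj_getVert_succ (i := 0) (by omega))
    (by
      have := (P j).adj_getVert_succ (i := (P j).length - 1) (by omega)
      rw [Nat.sub_add_cancel (by omega), Walk.getVert_length] at this
      rw [Walk.drop_getVert, show 1 + ((P j).length - 2) = (P j).length - 1 by omega]
      exact this.symm)
    (by
      intro x hx y hy hxy
      obtain ⟨t, ht, ht', rfl⟩ := mem_support_take hy
      rw [Walk.drop_length] at ht'
      rw [Walk.drop_getVert] at hxy ⊢
      rw [Walk.drop_getVert]
      have hne : (P j).getVert (1 + t) ∉ (P i).support := by
        intro hmem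
        rcases h.disjoint i j hij _ hmem (Walk.getVert_mem_support _ _) with h1 | h1
        · have := (h.induced j).getVert_inj (j := 0) (by omega) (by omega)
            (h1.trans (P j).getVert_zero.symm)
          omega
        · have := (h.induced j).getVert_inj (by omega) le_rfl
            (h1.trans (P j).getVert_length.symm)
          omega
      rcases hxy with rfl | hxy
      · exact absurd hx hne
      rcases h.no_edges i j hij x hx _ (Walk.getVert_mem_support _ _) hxy with he | he
      · exact absurd (Walk.snd_mem_support_of_mem_edges _ he) hne
      rcases h.disjoint i j hij x hx (Walk.fst_mem_support_of_mem_edges _ he) with rfl | rfl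
      · have := (h.induced j).touch_getVert (i := 0) (j := 1 + t) (by omega) (by omega)
          (by rw [Walk.getVert_zero]; exact Or.inr hxy)
        exact Or.inl ⟨rfl, by rw [show 1 + t = 1 by omega]⟩
      · have := (h.induced j).touch_getVert (i := 1 + t) (j := (P j).length) (by omega) le_rfl
          (by rw [Walk.getVert_length]; exact Or.inr hxy.symm)
        exact Or.inr ⟨rfl, by rw [show t = (P j).length - 2 by omega]⟩)
    (by omega)
  rwa [hlen, show (P i).length + ((P j).length - 2) + 2 = (P i).length + (P j).length by omega]
    at this

/-- A path of length 0 would make the apex a vertex of the triangle, hence adjacent to the end of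
another path, which has length at least 2 and is induced. -/
theorem IsPyramid.one_le_length {a : V} {b : Fin 3 → V} {P : ∀ i, G.Walk a (b i)}
    (h : IsPyramid G a b P) (i : Fin 3) : 1 ≤ (P i).length := by
  obtain ⟨k, hk⟩ := h.two_le_length
  by_contra hi
  have hi0 : (P i).length = 0 := by omega
  obtain rfl : i = k := by
    by_contra hik
    have := hk i hik
    omega
  obtain ⟨j, hj⟩ : ∃ j, j ≠ i := exists_ne i
  have hab : a = b i := Walk.eq_of_length_eq_zero hi0
  have hadj : G.Adj a (b j) := hab ▸ h.triangle i j hj.symm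
  have := (h.induced j).touch_getVert (i := 0) (j := (P j).length)
    (by have := hk j hj; omega) le_rfl
    (by rw [Walk.getVert_zero, Walk.getVert_length]; exact Or.inr hadj)
  have := hk j hj
  omega

theorem IsPyramid.hasHole {a : V} {b : Fin 3 → V} {P : ∀ i, G.Walk a (b i)}
    (h : IsPyramid G a b P) {i j : Fin 3} (hij : i ≠ j) :
    HasHole G ((P i).length + (P j).length + 1) := by
  have hi := h.one_le_length i
  have hj := h.one_le_length j
  have hlen : ((P j).drop 1).length = (P j).length - 1 := Walk.drop_length _ _
  have h2 : 3 ≤ (P i).length + (P j).length := by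
    obtain ⟨k, hk⟩ := h.two_le_length
    by_cases hik : i = k
    · have := hk j (by rw [← hik]; exact hij.symm)
      omega
    · have := hk i hik
      omega
  have := hasHole_of_paths (h.induced i) ((h.induced j).drop 1)
    (by simpa using (P j).adj_getVert_succ (i := 0) (by omega))
    (h.triangle i j hij)
    (by
      intro x hx y hy hxy
      obtain ⟨t, ht, ht', rfl⟩ := mem_support_drop hj hy
      have hne : (P j).getVert t ∉ (P i).support := by
        intro hmem
        have h1 := h.disjoint i j hij _ hmem (Walk.getVert_mem_support _ _)
        have := (h.induced j).getVert_inj (j := 0) (by omega) (by omega)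
          (h1.trans (P j).getVert_zero.symm)
        omega
      rcases hxy with rfl | hxy
      · exact absurd hx hne
      rcases h.no_edges i j hij x hx _ (Walk.getVert_mem_support _ _) hxy with he | he | he
      · exact absurd (Walk.snd_mem_support_of_mem_edges _ he) hne
      · obtain rfl := h.disjoint i j hij x hx (Walk.fst_mem_support_of_mem_edges _ he)
        have := (h.induced j).touch_getVert (i := 0) (j := t) (by omega) (by omega)
          (by rw [Walk.getVert_zero]; exact Or.inr hxy)
        exact Or.inl ⟨rfl, by rw [show t = 1 by omega]⟩
      · exact Or.inr he)
    (by omega)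
  rwa [hlen, show (P i).length + ((P j).length - 1) + 2 = (P i).length + (P j).length + 1 by omega]
    at this

theorem IsPrism.hasHole {a b : Fin 3 → V} {P : ∀ i, G.Walk (a i) (b i)}
    (h : IsPrism G a b P) {i j : Fin 3} (hij : i ≠ j) :
    HasHole G ((P i).length + (P j).length + 2) := by
  have hi := h.one_le_length i
  have hj := h.one_le_length j
  refine hasHole_of_paths (h.induced i) (h.induced j) (h.triangle_left i j hij)
    (h.triangle_right i j hij) ?_ (by omega)
  rintro x hx y hy (rfl | hxy)
  · exact absurd hy (h.disjoint i j hij x hx)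
  · exact h.no_edges i j hij x hx y hy hxy

/-- In a monoholed graph, the lengths of the `3`-path configurations are almost constant. -/
theorem Monoholed.almost_uniform (h : Monoholed G) :
    ∃ L, ∀ l, HasThreePathConfiguration G l → ∀ i, L ≤ l i + 1 ∧ l i ≤ L := by
  obtain ⟨n, hn⟩ := h
  -- If the three pairwise sums all equal `n - c` with `c ≤ 2`, each length is half of that, which
  -- is `n / 2` rounded down or one less.
  refine ⟨n / 2, ?_⟩
  have key : ∀ (l : Fin 3 → ℕ) (c : ℕ), c ≤ 2 → (∀ i j, i ≠ j → l i + l j + c = n) →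
      ∀ i, n / 2 ≤ l i + 1 ∧ l i ≤ n / 2 := by
    intro l c hc hl
    have h01 := hl 0 1 (by decide)
    have h02 := hl 0 2 (by decide)
    have h12 := hl 1 2 (by decide)
    refine forall_fin_three.2 ⟨?_, ?_, ?_⟩ <;> omega
  rintro l (⟨a, b, P, hP, hPl⟩ | ⟨a, b, P, hP, hPl⟩ | ⟨a, b, P, hP, hPl⟩)
  · refine key l 0 (by omega) fun i j hij => ?_
    rw [← hPl, ← hPl]
    exact hn _ (hP.hasHole hij)
  · refine key l 1 (by omega) fun i j hij => ?_
    rw [← hPl, ← hPl]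
    exact hn _ (hP.hasHole hij)
  · refine key l 2 (by omega) fun i j hij => ?_
    rw [← hPl, ← hPl]
    exact hn _ (hP.hasHole hij)

theorem Monoholed.not_hasFatMinor (h : Monoholed G) : ¬ HasFatMinor 10 (fan 4) G := by
  obtain ⟨L, hL⟩ := h.almost_uniform
  exact not_hasFatMinor_of_almost_uniform L hL

theorem UniformThreePathConfigurations.not_hasFatMinor (h : UniformThreePathConfigurations G) :
    ¬ HasFatMinor 10 (fan 4) G := by
  obtain ⟨L, hL⟩ := h
  refine not_hasFatMinor_of_almost_uniform L fun l hl i => ?_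
  have := hL l hl i
  omega

/-! ### Covering isometric paths by rooted ones. -/

/-- The vertex set of an isometric path that starts in `r`. -/
def IsRooted (G : SimpleGraph V) (r : V) (A : Set V) : Prop :=
  ∃ (t : V) (q : G.Walk r t), IsIsometricPath q ∧ A = {x | x ∈ q.support}

theorem isRooted_singleton (r : V) : IsRooted G r {r} :=
  ⟨r, .nil, by simp [IsIsometricPath], by simp⟩

theorem coveredByRooted_iff {r : V} {k : ℕ} {S : Set V} :
    CoveredByRooted G r k S ↔
      ∃ A : Fin k → Set V, (∀ i, IsRooted G r (A i)) ∧ ∀ x ∈ S, ∃ i, x ∈ A i := by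
  constructor
  · rintro ⟨t, q, hq, h⟩
    exact ⟨fun i => {x | x ∈ (q i).support}, fun i => ⟨t i, q i, hq i, rfl⟩, h⟩
  · rintro ⟨A, hA, h⟩
    choose t q hq hAq using hA
    refine ⟨t, q, hq, fun x hx => ?_⟩
    obtain ⟨i, hi⟩ := h x hx
    rw [hAq] at hi
    exact ⟨i, hi⟩

theorem CoveredByRooted.union {r : V} {k m : ℕ} {S T : Set V} (hS : CoveredByRooted G r k S)
    (hT : CoveredByRooted G r m T) : CoveredByRooted G r (k + m) (S ∪ T) := by
  rw [coveredByRooted_iff] at *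
  obtain ⟨A, hA, hAS⟩ := hS
  obtain ⟨B, hB, hBT⟩ := hT
  refine ⟨Fin.append A B, ?_, ?_⟩
  · refine Fin.addCases (fun i => ?_) fun i => ?_
    · rw [Fin.append_left]
      exact hA i
    · rw [Fin.append_right]
      exact hB i
  · rintro x (hx | hx)
    · obtain ⟨i, hi⟩ := hAS x hx
      exact ⟨Fin.castAdd m i, by rwa [Fin.append_left]⟩
    · obtain ⟨i, hi⟩ := hBT x hx
      exact ⟨Fin.natAdd k i, by rwa [Fin.append_right]⟩

theorem CoveredByRooted.subset {r : V} {k : ℕ} {S T : Set V} (hT : CoveredByRooted G r k T)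
    (hST : S ⊆ T) : CoveredByRooted G r k S := by
  obtain ⟨t, q, hq, h⟩ := hT
  exact ⟨t, q, hq, fun x hx => h x (hST hx)⟩

theorem coveredByRooted_empty (r : V) (k : ℕ) : CoveredByRooted G r k ∅ :=
  coveredByRooted_iff.2 ⟨fun _ => {r}, fun _ => isRooted_singleton r, fun _ h => h.elim⟩

theorem IsRooted.covered {r : V} {A : Set V} (h : IsRooted G r A) : CoveredByRooted G r 1 A :=
  coveredByRooted_iff.2 ⟨fun _ => A, fun _ => h, fun _ hx => ⟨0, hx⟩⟩

theorem exists_segment {a b : V} (p : G.Walk a b) {s t : ℕ} (hst : s ≤ t) (ht : t ≤ p.length) :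
    ∃ q : G.Walk (p.getVert s) (p.getVert t), q.length = t - s ∧
      ∀ x, x ∈ q.support ↔ ∃ i, s ≤ i ∧ i ≤ t ∧ p.getVert i = x := by
  refine ⟨((p.drop s).take (t - s)).copy rfl
    (by rw [Walk.drop_getVert, Nat.add_sub_cancel' hst]), ?_, fun x => ?_⟩
  · rw [Walk.length_copy, Walk.take_length, Walk.drop_length]
    omega
  · rw [Walk.support_copy]
    constructor
    · intro hx
      obtain ⟨i, hi, hi', rfl⟩ := mem_support_take hx
      exact ⟨s + i, by omega, by omega, by rw [Walk.drop_getVert]⟩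
    · rintro ⟨i, hi, hi', rfl⟩
      have : ((p.drop s).take (t - s)).getVert (i - s) = p.getVert i := by
        rw [Walk.take_getVert, Walk.drop_getVert, min_eq_right (by omega), Nat.add_sub_cancel' hi]
      rw [← this]
      exact Walk.getVert_mem_support _ _

theorem IsIsometricPath.dist_getVert {a b : V} {p : G.Walk a b} (hp : IsIsometricPath p)
    (hG : G.Connected) {s t : ℕ} (hst : s ≤ t) (ht : t ≤ p.length) :
    G.dist (p.getVert s) (p.getVert t) = t - s := by
  obtain ⟨q, hq, -⟩ := exists_segment p hst ht
  have h1 : G.dist (p.getVert s) (p.getVert t) ≤ t - s := hq ▸ dist_le q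
  have h2 : G.dist a (p.getVert s) ≤ s := by
    have := dist_le (p.take s)
    rw [Walk.take_length] at this
    omega
  have h3 : G.dist (p.getVert t) b ≤ p.length - t := by
    have := dist_le (p.drop t)
    rwa [Walk.drop_length] at this
  have h4 := hG.dist_triangle (u := a) (v := p.getVert s) (w := b)
  have h5 := hG.dist_triangle (u := p.getVert s) (v := p.getVert t) (w := b)
  have h6 : p.length = G.dist a b := hp
  omega

/-- The part of a walk along which the distance to `r` changes as fast as possible is contained in
an isometric path that starts in `r`. -/
theorem exists_isRooted_segment (hG : G.Connected) (r : V) {a b : V} (p : G.Walk a b) {s t : ℕ}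
    (hst : s ≤ t) (ht : t ≤ p.length)
    (h : G.dist r (p.getVert t) = G.dist r (p.getVert s) + (t - s) ∨
      G.dist r (p.getVert s) = G.dist r (p.getVert t) + (t - s)) :
    ∃ A, IsRooted G r A ∧ ∀ i, s ≤ i → i ≤ t → p.getVert i ∈ A := by
  obtain ⟨q, hq, hqS⟩ := exists_segment p hst ht
  rcases h with h | h
  · obtain ⟨v, hv⟩ := hG.exists_walk_length_eq_dist r (p.getVert s)
    refine ⟨_, ⟨_, v.append q, ?_, rfl⟩, fun i hi hi' => ?_⟩
    · rw [IsIsometricPath, Walk.length_append, hv, hq, h]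
    · exact (Walk.mem_support_append_iff _ _).2 (Or.inr ((hqS _).2 ⟨i, hi, hi', rfl⟩))
  · obtain ⟨v, hv⟩ := hG.exists_walk_length_eq_dist r (p.getVert t)
    refine ⟨_, ⟨_, v.append q.reverse, ?_, rfl⟩, fun i hi hi' => ?_⟩
    · rw [IsIsometricPath, Walk.length_append, Walk.length_reverse, hv, hq, h]
    · refine (Walk.mem_support_append_iff _ _).2 (Or.inr ?_)
      rw [Walk.support_reverse, List.mem_reverse]
      exact (hqS _).2 ⟨i, hi, hi', rfl⟩

/-- The vertices of an isometric path, from the `s`-th on, can be covered by few rooted isometric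
paths, or there is a long sequence of vertices any two of which lie on no common rooted isometric
path. -/
theorem IsIsometricPath.covered_or_exists_antichain (hG : G.Connected) (r : V) {a b : V}
    {p : G.Walk a b} (hp : IsIsometricPath p) (m : ℕ) : ∀ s ≤ p.length,
    CoveredByRooted G r (2 * m) {x | ∃ i, s ≤ i ∧ i ≤ p.length ∧ p.getVert i = x} ∨
    ∃ τ : ℕ → ℕ, τ 0 = s ∧ (∀ i ≤ m, τ i ≤ p.length) ∧ ∀ i < m,
      G.dist r (p.getVert (τ (i + 1))) + τ i < G.dist r (p.getVert (τ i)) + τ (i + 1) ∧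
      G.dist r (p.getVert (τ i)) + τ i < G.dist r (p.getVert (τ (i + 1))) + τ (i + 1) := by
  classical
  set f : ℕ → ℕ := fun i => G.dist r (p.getVert i) with hf
  have hLip : ∀ i j, i ≤ j → j ≤ p.length → f j ≤ f i + (j - i) ∧ f i ≤ f j + (j - i) := by
    intro i j hij hj
    have h1 := hp.dist_getVert hG hij hj
    have h2 := hG.dist_triangle (u := r) (v := p.getVert i) (w := p.getVert j)
    have h3 := hG.dist_triangle (u := r) (v := p.getVert j) (w := p.getVert i)
    rw [dist_comm (u := p.getVert j)] at h3
    rw [h1] at h2 h3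
    exact ⟨h2, h3⟩
  induction m with
  | zero => exact fun s hs => Or.inr ⟨fun _ => s, rfl, fun _ _ => hs, fun _ h => absurd h (by omega)⟩
  | succ m ih =>
    intro s hs
    -- One rooted path reaches as far as the last vertex at which `f` has grown at full speed since
    -- `s`, and one as far as the last at which it has fallen at full speed.
    have hcov : CoveredByRooted G r 2 {x | ∃ i, s ≤ i ∧ i ≤ p.length ∧
        (f i = f s + (i - s) ∨ f s = f i + (i - s)) ∧ p.getVert i = x} := by
      have one : ∀ P : ℕ → Prop, P s → (∀ i, s ≤ i → i ≤ p.length → P i →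
          (f i = f s + (i - s) ∨ f s = f i + (i - s))) →
          CoveredByRooted G r 1 {x | ∃ i, s ≤ i ∧ i ≤ p.length ∧ P i ∧ p.getVert i = x} := by
        intro P hPs hP
        obtain ⟨α, β, -, hβ, -, ⟨hsβ, hPβ⟩, hmax⟩ :=
          exists_first_last (P := fun i => s ≤ i ∧ P i) ⟨s, hs, le_rfl, hPs⟩
        obtain ⟨A, hA, hAS⟩ := exists_isRooted_segment hG r p hsβ hβ (hP β hsβ hβ hPβ)
        refine hA.covered.subset ?_
        rintro x ⟨i, hi, hi', hPi, rfl⟩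
        exact hAS i hi (hmax i hi' ⟨hi, hPi⟩).2
      refine ((one (fun i => f i = f s + (i - s)) (by simp) fun i _ _ h => Or.inl h).union
        (one (fun i => f s = f i + (i - s)) (by simp) fun i _ _ h => Or.inr h)).subset ?_
      rintro x ⟨i, hi, hi', h | h, rfl⟩
      · exact Or.inl ⟨i, hi, hi', h, rfl⟩
      · exact Or.inr ⟨i, hi, hi', h, rfl⟩
    by_cases hex : ∃ t, s ≤ t ∧ t ≤ p.length ∧ f t + s < f s + t ∧ f s + s < f t + t
    · obtain ⟨hst, ht, h1, h2⟩ := Nat.find_spec hex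
      rcases ih (Nat.find hex) ht with h | ⟨τ, hτ0, hτn, hτ⟩
      · left
        rw [show 2 * (m + 1) = 2 + 2 * m by ring]
        refine (hcov.union h).subset ?_
        rintro x ⟨i, hi, hi', rfl⟩
        by_cases hit : Nat.find hex ≤ i
        · exact Or.inr ⟨i, hit, hi', rfl⟩
        · refine Or.inl ⟨i, hi, hi', ?_, rfl⟩
          have := Nat.find_min hex (not_le.1 hit)
          have := hLip s i hi hi'
          omega
      · right
        refine ⟨fun i => if i = 0 then s else τ (i - 1), rfl, fun i hi => ?_, fun i hi => ?_⟩
        · dsimp only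
          split_ifs
          · exact hs
          · exact hτn _ (by omega)
        · rcases Nat.eq_zero_or_pos i with rfl | hi0
          · simp only [zero_add, one_ne_zero, ↓reduceIte, Nat.sub_self, hτ0]
            exact ⟨h1, h2⟩
          · have := hτ (i - 1) (by omega)
            rw [Nat.sub_add_cancel hi0] at this
            simpa only [show i ≠ 0 by omega, show i + 1 ≠ 0 by omega, if_false,
              Nat.add_sub_cancel] using this
    · left
      rw [show 2 * (m + 1) = 2 + 2 * m by ring]
      refine (hcov.union (coveredByRooted_empty r (2 * m))).subset ?_
      rintro x ⟨i, hi, hi', rfl⟩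
      refine Or.inl ⟨i, hi, hi', ?_, rfl⟩
      have h1 : ¬ (f i + s < f s + i ∧ f s + s < f i + i) := fun h => hex ⟨i, hi, hi', h⟩
      have := hLip s i hi hi'
      omega

/-! ### Fat fans along an isometric path. -/

/-- A system of vertex sets with the distances required by a fat minor model of the fan `U₄`. -/
theorem hasFatMinor_of_pieces {K : ℕ} (S : Option (Fin 4) ⊕ (Fin 4 ⊕ Fin 3) → Set V)
    (hS : ∀ l, JoinedIn G (S l)) (hinc : ∀ w e, w ∈ fanEdge e → (S (.inl w) ∩ S (.inr e)).Nonempty)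
    (hfar : ∀ l l', separated l l' = true → FarApart G K (S l) (S l')) :
    HasFatMinor K (fan 4) G := by
  choose φ hφ using fun e : (fan 4).edgeSet => exists_fanEdge e.2
  have hne : ∀ w, (S (.inl w)).Nonempty := by
    have : ∀ w : Option (Fin 4), ∃ e, w ∈ fanEdge e := by decide
    intro w
    obtain ⟨e, he⟩ := this w
    exact (hinc w e he).mono Set.inter_subset_left
  have hne' : ∀ e, (S (.inr e)).Nonempty := by
    have : ∀ e, ∃ w : Option (Fin 4), w ∈ fanEdge e := by decide
    intro e
    obtain ⟨w, hw⟩ := this e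
    exact (hinc w e hw).mono Set.inter_subset_right
  refine ⟨⟨fun w => (⊤ : G.Subgraph).induce (S (.inl w)),
    fun e => (⊤ : G.Subgraph).induce (S (.inr (φ e))), fun w => (hS _).connected (hne w),
    fun e => (hS _).connected (hne' _), fun w e hwe => hinc w _ (by rwa [hφ]), ?_, ?_, ?_⟩⟩
  · intro w w' hw
    exact hfar _ _ (by simpa [separated] using hw)
  · intro e e' he
    refine hfar _ _ ?_
    simp only [separated, decide_eq_true_eq]
    intro h
    exact he (Subtype.ext (by rw [← hφ e, ← hφ e', h]))
  · intro w e hwe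
    refine hfar _ _ ?_
    simp only [separated, decide_eq_true_eq, hφ]
    exact hwe

/-- An isometric path from which four long paths to `r` depart at distant places gives rise to a
fat minor model of the fan `U₄`. -/
theorem IsIsometricPath.hasFatMinor (hG : G.Connected) (r : V) {a b : V} {p : G.Walk a b}
    (hp : IsIsometricPath p) (t : Fin 4 → ℕ) (ht : ∀ i, t i ≤ p.length)
    (hgap : ∀ i j, i < j → t i + 50 ≤ t j) (z : Fin 4 → V)
    (ℓ : ∀ i, G.Walk (p.getVert (t i)) (z i)) (W : ∀ i, G.Walk (z i) r)
    (hℓ : ∀ i, ∀ x ∈ (ℓ i).support, G.dist (p.getVert (t i)) x ≤ 10)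
    (hW : ∀ i, ∀ x ∈ (W i).support, ∀ k ≤ p.length, 10 ≤ G.dist x (p.getVert k)) :
    HasFatMinor 10 (fan 4) G := by
  let arc : ℕ → ℕ → Set V := fun lo hi => {x | ∃ k, lo ≤ k ∧ k ≤ hi ∧ k ≤ p.length ∧
    p.getVert k = x}
  have hjoin : ∀ lo hi, JoinedIn G (arc lo hi) := by
    rintro lo hi x ⟨i, hi1, hi2, hi3, rfl⟩ y ⟨j, hj1, hj2, hj3, rfl⟩
    rcases le_total i j with hij | hij
    · obtain ⟨q, -, hq⟩ := exists_segment p hij hj3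
      refine ⟨q, fun z hz => ?_⟩
      obtain ⟨k, hk, hk', rfl⟩ := (hq z).1 hz
      exact ⟨k, by omega, by omega, by omega, rfl⟩
    · obtain ⟨q, -, hq⟩ := exists_segment p hij hi3
      refine ⟨q.reverse, fun z hz => ?_⟩
      rw [Walk.support_reverse, List.mem_reverse] at hz
      obtain ⟨k, hk, hk', rfl⟩ := (hq z).1 hz
      exact ⟨k, by omega, by omega, by omega, rfl⟩
  -- The hub is the union of the walks `W i`, which meet in `r`. Branch sets are arcs of radius 20
  -- around the feet `t i`. A leg stays within 10 of its foot, hence 10 away from the arcs that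
  -- start 20 further on, and the gap `50 = 20 + 10 + 20` keeps the branch sets apart. Truncation of
  -- `t i - 20` at 0 is harmless.
  let S : Option (Fin 4) ⊕ (Fin 4 ⊕ Fin 3) → Set V
    | .inl none => {x | ∃ i, x ∈ (W i).support}
    | .inl (some i) => arc (t i - 20) (t i + 20)
    | .inr (.inl i) => {x | x ∈ (ℓ i).support}
    | .inr (.inr i) => arc (t i.castSucc + 20) (t i.succ - 20)
  have hle : ∀ {x y : V}, 10 ≤ G.dist x y → ((10 : ℕ) : ℕ∞) ≤ G.edist x y := by
    intro x y h
    rw [← (hG x y).coe_dist_eq_edist]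
    exact_mod_cast h
  have hdist : ∀ {i j}, i ≤ p.length → j ≤ p.length →
      (j ≤ i + G.dist (p.getVert i) (p.getVert j)) ∧
      (i ≤ j + G.dist (p.getVert i) (p.getVert j)) := by
    intro i j hi hj
    rcases le_total i j with hij | hij
    · have := hp.dist_getVert hG hij hj
      omega
    · have := hp.dist_getVert hG hij hi
      rw [dist_comm] at this
      omega
  have arc_arc : ∀ {lo hi lo' hi'}, hi + 10 ≤ lo' → FarApart G 10 (arc lo hi) (arc lo' hi') := by
    rintro lo hi lo' hi' h x ⟨i, h1, h2, h3, rfl⟩ y ⟨j, h1', h2', h3', rfl⟩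
    have := hdist h3 h3'
    exact hle (by omega)
  have leg_arc : ∀ {i lo hi}, (t i + 20 ≤ lo ∨ hi + 20 ≤ t i) →
      FarApart G 10 {x | x ∈ (ℓ i).support} (arc lo hi) := by
    rintro i lo hi h x hx y ⟨j, h1, h2, h3, rfl⟩
    have h4 := hdist (ht i) h3
    have h5 := hℓ i x hx
    have h6 := hG.dist_triangle (u := p.getVert (t i)) (v := x) (w := p.getVert j)
    exact hle (by omega)
  have leg_leg : ∀ {i j}, i < j →
      FarApart G 10 {x | x ∈ (ℓ i).support} {x | x ∈ (ℓ j).support} := by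
    intro i j hij x hx y hy
    have h4 := hdist (ht i) (ht j)
    have h5 := hℓ i x hx
    have h5' := hℓ j y hy
    have h6 := hG.dist_triangle (u := p.getVert (t i)) (v := x) (w := p.getVert (t j))
    have h7 := hG.dist_triangle (u := x) (v := y) (w := p.getVert (t j))
    rw [dist_comm (u := y)] at h7
    have := hgap i j hij
    exact hle (by omega)
  have hub_arc : ∀ {lo hi}, FarApart G 10 {x | ∃ i, x ∈ (W i).support} (arc lo hi) := by
    rintro lo hi x ⟨i, hx⟩ y ⟨j, -, -, h3, rfl⟩
    exact hle (hW i x hx j h3)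
  have hgap' : ∀ i j, i ≤ j → t i ≤ t j := by
    intro i j hij
    rcases hij.eq_or_lt with rfl | hij
    · exact le_rfl
    · have := hgap i j hij
      omega
  have disj : ∀ {i : Fin 4} {j : Fin 3}, some i ∉ fanEdge (.inr j) → i < j.castSucc ∨ j.succ < i := by
    decide
  have cross : ∀ {i : Fin 4} {j : Fin 3}, i ≤ j.castSucc ∨ j.succ ≤ i := by decide
  have between : ∀ {i j : Fin 3}, i < j → i.succ ≤ j.castSucc := by decide
  have ne_spoke : ∀ {i j : Fin 4}, some i ∉ fanEdge (.inl j) → i ≠ j := by decide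
  have set_path : ∀ w e, w ∉ fanEdge e → FarApart G 10 (S (.inl w)) (S (.inr e)) := by
    rintro (_ | i) (j | j) h
    · exact absurd h (by revert j; decide)
    · exact hub_arc
    · have := ne_spoke h
      rcases lt_or_gt_of_ne this with hij | hij <;> have := hgap _ _ hij
      · exact (leg_arc (Or.inr (by omega))).symm
      · exact (leg_arc (Or.inl (by omega))).symm
    · rcases disj h with hij | hij <;> have := hgap _ _ hij
      · exact arc_arc (by omega)
      · exact (arc_arc (by omega)).symm
  refine hasFatMinor_of_pieces S ?_ ?_ ?_
  · rintro ((_ | i) | (i | i))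
    · refine JoinedIn.of_base r ?_
      rintro x ⟨i, hx⟩
      classical
      exact ⟨(W i).dropUntil x hx, fun y hy =>
        ⟨i, (W i).support_dropUntil_subset_support hx hy⟩⟩
    · exact hjoin _ _
    · exact JoinedIn.support _
    · exact hjoin _ _
  · have self : ∀ i, p.getVert (t i) ∈ arc (t i - 20) (t i + 20) := fun i =>
      ⟨t i, by omega, by omega, ht i, rfl⟩
    rintro w (j | j) h
    · simp only [fanEdge, Sum.elim_inl, Sym2.mem_iff] at h
      rcases h with rfl | rfl
      · exact ⟨z j, ⟨j, Walk.start_mem_support _⟩, Walk.end_mem_support _⟩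
      · exact ⟨_, self j, Walk.start_mem_support _⟩
    · simp only [fanEdge, Sum.elim_inr, Sym2.mem_iff] at h
      have h1 := hgap j.castSucc j.succ (Fin.castSucc_lt_succ)
      have h2 := ht j.succ
      rcases h with rfl | rfl
      · exact ⟨p.getVert (t j.castSucc + 20), ⟨_, by omega, by omega, by omega, rfl⟩,
          ⟨_, by omega, by omega, by omega, rfl⟩⟩
      · exact ⟨p.getVert (t j.succ - 20), ⟨_, by omega, by omega, by omega, rfl⟩,
          ⟨_, by omega, by omega, by omega, rfl⟩⟩
  · rintro (w | e) (w' | e') h <;> simp only [separated, decide_eq_true_eq] at h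
    · rcases w with _ | i <;> rcases w' with _ | j
      · exact absurd rfl h
      · exact hub_arc
      · exact hub_arc.symm
      · have hij : i ≠ j := fun hij => h (congrArg some hij)
        rcases lt_or_gt_of_ne hij with hij | hij <;> have := hgap _ _ hij
        · exact arc_arc (by omega)
        · exact (arc_arc (by omega)).symm
    · exact set_path _ _ h
    · exact (set_path _ _ h).symm
    · have leg_seg : ∀ (i : Fin 4) (j : Fin 3),
          FarApart G 10 (S (.inr (.inl i))) (S (.inr (.inr j))) := by
        intro i j
        rcases cross (i := i) (j := j) with hij | hij <;> have := hgap' _ _ hij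
        · exact leg_arc (Or.inl (by omega))
        · refine leg_arc (Or.inr ?_)
          have := hgap j.castSucc j.succ (Fin.castSucc_lt_succ)
          omega
      rcases e with i | i <;> rcases e' with j | j
      · have hij : i ≠ j := fun hij => h (congrArg Sum.inl hij)
        rcases lt_or_gt_of_ne hij with hij | hij
        · exact leg_leg hij
        · exact (leg_leg hij).symm
      · exact leg_seg i j
      · exact (leg_seg j i).symm
      · have hij : i ≠ j := fun hij => h (congrArg Sum.inr hij)
        have key : ∀ {i j : Fin 3}, i < j →
            FarApart G 10 (S (.inr (.inr i))) (S (.inr (.inr j))) := by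
          intro i j hij
          have := hgap' _ _ (between hij)
          have := hgap i.castSucc i.succ (Fin.castSucc_lt_succ)
          exact arc_arc (by omega)
        rcases lt_or_gt_of_ne hij with hij | hij
        · exact key hij
        · exact (key hij).symm

/-- A shortest walk to `r` from a vertex of the isometric path `p` leaves the neighbourhood of `p`
for good near some vertex of `p`. -/
theorem IsIsometricPath.exists_departure (hG : G.Connected) (r : V) {a b : V} {p : G.Walk a b}
    (hp : IsIsometricPath p) (hfar : ∀ k ≤ p.length, 10 ≤ G.dist r (p.getVert k)) {t₀ : ℕ}
    (ht₀ : t₀ ≤ p.length) :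
    ∃ t ≤ p.length,
      G.dist r (p.getVert t) + t ≤ G.dist r (p.getVert t₀) + t₀ + 18 ∧
      G.dist r (p.getVert t) + t₀ ≤ G.dist r (p.getVert t₀) + t + 18 ∧
      ∃ (z : V) (ℓ : G.Walk (p.getVert t) z) (W : G.Walk z r),
        (∀ x ∈ ℓ.support, G.dist (p.getVert t) x ≤ 10) ∧
        ∀ x ∈ W.support, ∀ k ≤ p.length, 10 ≤ G.dist x (p.getVert k) := by
  classical
  obtain ⟨v, hv⟩ := hG.exists_walk_length_eq_dist (p.getVert t₀) r
  have hiso : IsIsometricPath v := hv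
  -- `β` indexes the last vertex of `v` within distance 9 of `p`, and `t` indexes a vertex of `p`
  -- that near to it.
  obtain ⟨α, β, -, hβ, -, ⟨t, ht, hβt⟩, hmax⟩ := exists_first_last
    (P := fun i => ∃ k ≤ p.length, G.dist (v.getVert i) (p.getVert k) ≤ 9) (n := v.length)
    ⟨0, Nat.zero_le _, t₀, ht₀, by simp⟩
  have hβ' : β < v.length := by
    refine lt_of_le_of_ne hβ fun he => ?_
    rw [he, Walk.getVert_length] at hβt
    have := hfar t ht
    omega
  have d1 : G.dist (p.getVert t₀) (v.getVert β) = β := by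
    have := hiso.dist_getVert hG (Nat.zero_le β) hβ
    rwa [Walk.getVert_zero, Nat.sub_zero] at this
  have d2 : G.dist (v.getVert β) r = v.length - β := by
    have := hiso.dist_getVert hG hβ le_rfl
    rwa [Walk.getVert_length] at this
  have d3 : t ≤ t₀ + G.dist (p.getVert t₀) (p.getVert t) ∧
      t₀ ≤ t + G.dist (p.getVert t₀) (p.getVert t) := by
    rcases le_total t₀ t with h | h
    · have := hp.dist_getVert hG h ht
      omega
    · have := hp.dist_getVert hG h ht₀
      rw [dist_comm] at this
      omega
  have d4 := hG.dist_triangle (u := p.getVert t₀) (v := v.getVert β) (w := p.getVert t)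
  have d5 := hG.dist_triangle (u := r) (v := v.getVert β) (w := p.getVert t)
  rw [dist_comm (u := r) (v := v.getVert β)] at d5
  rw [dist_comm] at hv
  obtain ⟨e, he⟩ := hG.exists_walk_length_eq_dist (p.getVert t) (v.getVert β)
  rw [dist_comm] at he
  -- The leg has at most 9 edges up to `v.getVert β` and one more. In the two bounds, `18 = 9 + 9`:
  -- the step between `v` and `p` enters both into the distance to `r` and into the distance from
  -- `t₀` to `t`.
  refine ⟨t, ht, by omega, by omega, v.getVert (β + 1),
    e.append (v.adj_getVert_succ hβ').toWalk, v.drop (β + 1), ?_, ?_⟩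
  · intro x hx
    have h1 := dist_le ((e.append (v.adj_getVert_succ hβ').toWalk).takeUntil x hx)
    have h2 := (e.append (v.adj_getVert_succ hβ').toWalk).length_takeUntil_le_length hx
    have h3 : (e.append (v.adj_getVert_succ hβ').toWalk).length = e.length + 1 := by simp
    omega
  · intro x hx k hk
    obtain ⟨i, hi, hi', rfl⟩ := mem_support_drop hβ' hx
    by_contra hlt
    have := (hmax i hi' ⟨k, hk, by omega⟩).2
    omega

/-- A connected graph without the fan `U₄` as a `10`-fat minor has bounded strong isometric path
complexity. -/
theorem strongIsometricPathComplexity_le (hG : G.Connected) (h : ¬ HasFatMinor 10 (fan 4) G) :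
    strongIsometricPathComplexity G ≤ (816 : ℕ) := by
  refine iInf₂_le 816 fun r a b p hp => ?_
  -- Here `816 = 2 * 408` and `408 = 6 * 68`, where `68 = 50 + 18` pays for the gap between feet and
  -- for the error of a departure.
  rcases hp.covered_or_exists_antichain hG r 408 0 (Nat.zero_le _) with hc | ⟨τ, -, hτn, hτ⟩
  · refine hc.subset fun x hx => ?_
    obtain ⟨i, hi, rfl⟩ := exists_getVert_of_mem hx
    exact ⟨i, Nat.zero_le _, hi, rfl⟩
  refine absurd ?_ h
  -- Index plus distance to `r` and index minus distance to `r` both strictly increase along `τ`, so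
  -- the gains add up.
  have hchain : ∀ d i, i + d ≤ 408 →
      G.dist r (p.getVert (τ (i + d))) + τ i + d ≤ G.dist r (p.getVert (τ i)) + τ (i + d) ∧
      G.dist r (p.getVert (τ i)) + τ i + d ≤ G.dist r (p.getVert (τ (i + d))) + τ (i + d) := by
    intro d
    induction d with
    | zero => intro i _; simp
    | succ d ih =>
      intro i hi
      have h1 := ih i (by omega)
      have h2 := hτ (i + d) (by omega)
      rw [show i + (d + 1) = i + d + 1 from rfl]
      omega
  -- The four entries `y 0`, `y 2`, `y 4`, `y 6` are starting points of departures; the odd entries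
  -- separate them.
  obtain ⟨y, hy⟩ : ∃ y : ℕ → ℕ, y = fun i => τ (68 * i) := ⟨_, rfl⟩
  have hyn : ∀ i ≤ 6, y i ≤ p.length := fun i hi => by
    rw [hy]
    exact hτn _ (by omega)
  have hyc : ∀ i < 6,
      G.dist r (p.getVert (y (i + 1))) + y i + 68 ≤ G.dist r (p.getVert (y i)) + y (i + 1) ∧
      G.dist r (p.getVert (y i)) + y i + 68 ≤ G.dist r (p.getVert (y (i + 1))) + y (i + 1) := by
    intro i hi
    rw [hy]
    exact hchain 68 (68 * i) (by omega)
  have hLip : ∀ i j, i ≤ j → j ≤ p.length →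
      G.dist r (p.getVert j) ≤ G.dist r (p.getVert i) + (j - i) ∧
      G.dist r (p.getVert i) ≤ G.dist r (p.getVert j) + (j - i) ∧
      j - i ≤ G.dist r (p.getVert i) + G.dist r (p.getVert j) := by
    intro i j hij hj
    have h1 := hp.dist_getVert hG hij hj
    have h2 := hG.dist_triangle (u := r) (v := p.getVert i) (w := p.getVert j)
    have h3 := hG.dist_triangle (u := r) (v := p.getVert j) (w := p.getVert i)
    have h4 := hG.dist_triangle (u := p.getVert i) (v := r) (w := p.getVert j)
    rw [dist_comm (u := p.getVert j)] at h3
    rw [dist_comm (v := r)] at h4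
    omega
  have hfar : ∀ k ≤ p.length, 10 ≤ G.dist r (p.getVert k) := by
    intro k hk
    -- On each side of a vertex at distance at most 9 from `r`, the distance to `r` grows at full
    -- speed up to a loss of 18. One of the two steps of size 68 between `y 0`, `y 1` and `y 2`
    -- contradicts this.
    by_contra hlt
    have h0 := hyc 0 (by norm_num)
    have h1 := hyc 1 (by norm_num)
    have hn0 := hyn 0 (by norm_num)
    have hn1 := hyn 1 (by norm_num)
    have hn2 := hyn 2 (by norm_num)
    simp only [zero_add, Nat.reduceAdd] at h0 h1
    rcases le_total k (y 1) with hk1 | hk1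
    · have h2 := hLip k _ hk1 hn1
      have h3 := hLip k (y 2) (by omega) hn2
      omega
    · have h2 := hLip _ k hk1 hk
      have h3 := hLip (y 0) k (by omega) hk
      omega
  have hdep : ∀ i : Fin 4, y (2 * i) ≤ p.length := fun i => hyn _ (by omega)
  choose t ht ht1 ht2 z ℓ W hℓ hW using fun i => hp.exists_departure hG r hfar (hdep i)
  have hsucc : ∀ i : Fin 3, t i.castSucc + 50 ≤ t i.succ := by
    intro i
    have h1 := hyc (2 * i) (by omega)
    have h2 := hyc (2 * i + 1) (by omega)
    have h3 := ht1 i.castSucc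
    have h4 := ht2 i.castSucc
    have h5 := ht1 i.succ
    have h6 := ht2 i.succ
    have hn := hyn (2 * i + 1) (by omega)
    simp only [Fin.val_castSucc, Fin.val_succ, Nat.mul_add, mul_one] at h3 h4 h5 h6
    have e : 2 * (i : ℕ) + 1 + 1 = 2 * i + 2 := rfl
    rw [e] at h2
    -- the departure points lie on the two sides of the vertex with index `2 * i + 1`
    have h7 : t i.castSucc ≤ y (2 * i + 1) := by
      -- Past the separating vertex, index plus distance has grown by at least 68, but a departure
      -- allows a growth of only 18. The other side uses index minus distance in the same way.
      by_contra hlt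
      have := hLip _ _ (not_le.1 hlt).le (ht _)
      omega
    have h8 : y (2 * i + 1) ≤ t i.succ := by
      by_contra hlt
      have := hLip _ _ (not_le.1 hlt).le hn
      omega
    -- On either side of the separating vertex a gain of at least `68 - 18 = 50` remains. As the
    -- distance to `r` changes by at most one per step, this takes at least 25 steps on each side.
    have h9 := hLip _ _ h7 hn
    have h10 := hLip _ _ h8 (ht _)
    omega
  have hgap : ∀ i j, i < j → t i + 50 ≤ t j := by
    have h0 : t 0 + 50 ≤ t 1 := hsucc 0
    have h1 : t 1 + 50 ≤ t 2 := hsucc 1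
    have h2 : t 2 + 50 ≤ t 3 := hsucc 2
    intro i j hij
    fin_cases i <;> fin_cases j <;> first | exact absurd hij (by decide) | (simp; omega)
  exact hp.hasFatMinor hG r t ht hgap z ℓ W hℓ hW

end FatMinors

theorem theorem2 :
    (∀ (V : Type u) [Finite V] (G : SimpleGraph V), FatMinors.Monoholed G →
      ¬ FatMinors.HasFatMinor 10 (FatMinors.fan 4) G) ∧
    (∀ (V : Type u) [Finite V] (G : SimpleGraph V), FatMinors.UniformThreePathConfigurations G →
      ¬ FatMinors.HasFatMinor 10 (FatMinors.fan 4) G) ∧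
    ¬ FatMinors.HasAsymptoticMinor.{u} (fun _ G => FatMinors.Monoholed G) (FatMinors.fan 4) ∧
    (∃ k : ℕ, ∀ (V : Type u) [Finite V] (G : SimpleGraph V), G.Connected →
      FatMinors.Monoholed G → FatMinors.strongIsometricPathComplexity G ≤ (k : ℕ∞)) := by
  refine ⟨fun V _ G h => h.not_hasFatMinor, fun V _ G h => h.not_hasFatMinor, fun h => ?_,
    816, fun V _ G hG h => FatMinors.strongIsometricPathComplexity_le hG h.not_hasFatMinor⟩
  obtain ⟨V, -, G, hG, hm⟩ := h 10 (by norm_num)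
  exact hG.not_hasFatMinor hm
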